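/- Let $\{\xi_i, i\ge 1\}$ be independent identically distributed real random variables with $E\xi_i=0$, $D\xi_i=\sigma^2$, $\sigma\in(0,\infty)$, and distribution function $F$. Let $\Phi$ be the standard normal distribution function, let $\Phi_n$ be the distribution function of $S_n=(\sigma\sqrt n)^{-1}(\xi_1+\cdots+\xi_n)$, and put $H(x)=F(x\sigma)-\Phi(x)$, with Lebesgue--Stieltjes signed measure $dH$ and total variation measure $|dH|$. Assume that - $\xi_i$ has a bounded density $p$ with $p(x)\le A_1$ for all $x\in\mathbb R$; - for some integer $m\ge 3$ the pseudomoments $\mu_k=\int_{\mathbb R}x^k\,dH(x)$, $k=3,\dots,m$, exist (that is, $\int_{\mathbb R}|x|^k\,|dH(x)|<\infty$) and are all equal to $0$. For $n\ge 1$ put $$\nu_n^{(1)}(m)=\int_{|x|\le\sigma\sqrt n}|x|^{m+1}\,|dH(x)|,\qquad \nu_n^{(2)}(m)=\int_{|x|>\sigma\sqrt n}|x|^{m}\,|dH(x)|,\qquad \nu_n(m)=\max\{\nu_n^{(1)}(m),\nu_n^{(2)}(m)\}.$$ Then, for every $n\ge 3$ with $\nu_n(m)<\tfrac12 e^{-3/2}$,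 $$\sup_{x\in\mathbb R}|\Phi_n(x)-\Phi(x)|\le 2C^{(1)}_m\frac{\nu_n^{(1)}(m)}{n^{(m-1)/2}}+2C^{(2)}_m\frac{\nu_n^{(2)}(m)}{n^{(m-2)/2}}+2\sigma A_1 b_1^{\,n-2}+\nu_n(m)\frac{4e^{3/2}}{\pi}\frac{e^{-n/2}}{n},$$ where $$C^{(1)}_m=\frac{12^{(m+1)/2}\,\Gamma\left(\frac{m+1}2\right)}{\pi(m+1)!},\qquad C^{(2)}_m=2C^{(1)}_{m-1},\qquad b_1=\exp\left\{-\frac{1}{96A_1^2\sigma^2(2+\pi)^2}\right\}<1.$$ -/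

import Mathlib

open MeasureTheory ProbabilityTheory

noncomputable section

namespace PseudoCLT

/-- The pseudomoment function `H(x) = F(xσ) - Φ(x)`, where `F` is the distribution function
of the law `L` and `Φ` is the standard normal distribution function. -/
def H (L : Measure ℝ) (σ x : ℝ) : ℝ :=
  cdf L (x * σ) - cdf (gaussianReal 0 1) x

/-- The signed Lebesgue-Stieltjes measure `dH`: the law of `ξ / σ` minus the standard
normal law (see `dH_Iic`). -/
def dH (L : Measure ℝ) [IsFiniteMeasure L] (σ : ℝ) : SignedMeasure ℝ :=
  (L.map (fun x => x / σ)).toSignedMeasure - (gaussianReal 0 1).toSignedMeasure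

/-- `dH` is the signed measure whose distribution function is `H`. -/
theorem dH_Iic (L : Measure ℝ) [IsProbabilityMeasure L] {σ : ℝ} (hσ : 0 < σ) (x : ℝ) :
    dH L σ (Set.Iic x) = H L σ x := by
  have hm : Measurable (fun y : ℝ => y / σ) := measurable_id.div_const σ
  have hs : (fun y : ℝ => y / σ) ⁻¹' Set.Iic x = Set.Iic (x * σ) := by
    ext y
    simp [div_le_iff₀ hσ]
  rw [dH, H, cdf_eq_real, cdf_eq_real, _root_.sub_apply,
    Measure.toSignedMeasure_apply_measurable measurableSet_Iic,
    Measure.toSignedMeasure_apply_measurable measurableSet_Iic,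
    measureReal_def, Measure.map_apply hm measurableSet_Iic, hs, measureReal_def]
  rfl

/-- The pseudomoment `μ_k = ∫ x^k dH(x)`. -/
def pseudomoment (L : Measure ℝ) [IsFiniteMeasure L] (σ : ℝ) (k : ℕ) : ℝ :=
  ∫ᵛ x, x ^ k ∂<•(dH L σ)

/-- The pseudomoment `μ_k` exists: `∫ |x|^k |dH(x)| < ∞`. -/
def PseudomomentExists (L : Measure ℝ) [IsFiniteMeasure L] (σ : ℝ) (k : ℕ) : Prop :=
  (dH L σ).Integrable (fun x : ℝ => x ^ k)

/-- The pseudomoment truncated from above,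
`ν_n^{(1)}(m) = ∫_{|x| ≤ σ√n} |x|^{m+1} |dH(x)|`. -/
def nu1 (L : Measure ℝ) [IsFiniteMeasure L] (σ : ℝ) (n m : ℕ) : ℝ :=
  ∫ x in {x : ℝ | |x| ≤ σ * √(n : ℝ)}, |x| ^ (m + 1) ∂(dH L σ).variation

/-- The pseudomoment truncated from below,
`ν_n^{(2)}(m) = ∫_{|x| > σ√n} |x|^m |dH(x)|`. -/
def nu2 (L : Measure ℝ) [IsFiniteMeasure L] (σ : ℝ) (n m : ℕ) : ℝ :=
  ∫ x in {x : ℝ | σ * √(n : ℝ) < |x|}, |x| ^ m ∂(dH L σ).variation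

/-- `ν_n(m) = max {ν_n^{(1)}(m), ν_n^{(2)}(m)}`. -/
def nu (L : Measure ℝ) [IsFiniteMeasure L] (σ : ℝ) (n m : ℕ) : ℝ :=
  max (nu1 L σ n m) (nu2 L σ n m)

/-- `C_m^{(1)} = 12^{(m+1)/2} Γ((m+1)/2) / (π (m+1)!)`. -/
def C1 (m : ℕ) : ℝ :=
  (12 : ℝ) ^ (((m : ℝ) + 1) / 2) * Real.Gamma (((m : ℝ) + 1) / 2) /
    (Real.pi * (Nat.factorial (m + 1) : ℝ))

/-- `C_m^{(2)} = 2 C_{m-1}^{(1)}` (used for `m ≥ 3`). -/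
def C2 (m : ℕ) : ℝ := 2 * C1 (m - 1)

/-- `b_1 = exp {-1 / (96 A₁² σ² (2+π)²)}`. -/
def b1 (A₁ σ : ℝ) : ℝ :=
  Real.exp (-(1 / (96 * A₁ ^ 2 * σ ^ 2 * (2 + Real.pi) ^ 2)))

/-- The normalized sum `S_n = (σ√n)⁻¹ (ξ_1 + ⋯ + ξ_n)`; the sequence is indexed from `0`. -/
def S {Ω : Type*} (ξ : ℕ → Ω → ℝ) (σ : ℝ) (n : ℕ) (ω : Ω) : ℝ :=
  (σ * √(n : ℝ))⁻¹ * ∑ i ∈ Finset.range n, ξ i ω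

end PseudoCLT

end

/-! Let `f` be the characteristic function of `ξ/σ` and `g(t) = exp(-t²/2)`. For laws with finite
mean the difference of the distribution functions is integrable and has Fourier transform
proportional to the difference of the characteristic functions divided by `t`. Fourier inversion
bounds the uniform distance by `(2π)⁻¹ ∫ |fⁿ - gⁿ| / |t| dt`: the factor `√n` disappears because
`dt/|t|` is scale invariant (`abs_cdf_sub_cdf_le`).

Normalization and the vanishing pseudomoments make all moments up to order `m` agree, so Taylor
polynomials cancel in `f - g`. Using the remainder of order `m+1` on small `x` and that of order `m`
on large `x` gives `|f - g| ≤ |t|^(m+1) ν₁/(m+1)! + 2|t|^m ν₂/m!` (`norm_charFun_sub_charFun_le`).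

The line is cut according to whether `2ν ≤ exp(-t²/2)` (`norm_pow_sub_exp_div_le`). If so, an
elementary inequality turns the Taylor bound into `|f| ≤ exp(-t²/8)`; then `|fⁿ - gⁿ| ≤ n |f - g|
exp(-(n-1)t²/8)`, and Gaussian moments produce the two main terms. Otherwise the assumption on `ν`
forces `t² > 3`, and `fⁿ`, `gⁿ` are bounded separately. There the bounded density gives `|f| ≤ b₁`
(`norm_charFun_le_exp`) and, by a Plancherel bound, `∫ |f|² ≤ 2πσA₁`
(`integral_norm_charFun_sq_le`), so `|f|ⁿ ≤ b₁^(n-2) |f|²` is integrable. The `gⁿ` part yields the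
last summand. -/

namespace PseudoCLT

open Real Set Filter Topology FourierTransform
open scoped ENNReal NNReal

/-! ### Fourier inversion for differences of distribution functions -/

/-- The kernel `1_{y ≤ x} - 1_{0 ≤ x}`, integrable in `x`. -/
noncomputable def stepKernel (y x : ℝ) : ℝ :=
  (Ici y).indicator 1 x - (Ici 0).indicator 1 x

lemma stepKernel_of_nonpos {y : ℝ} (hy : y ≤ 0) :
    stepKernel y = (Ico y 0).indicator 1 := by
  ext x
  simp only [stepKernel, indicator, mem_Ici, mem_Ico, Pi.one_apply]
  split_ifs <;> grind

lemma stepKernel_of_nonneg {y : ℝ} (hy : 0 ≤ y) :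
    stepKernel y = -(Ico 0 y).indicator 1 := by
  ext x
  simp only [stepKernel, indicator, mem_Ici, mem_Ico, Pi.one_apply, Pi.neg_apply]
  split_ifs <;> grind

lemma measurable_stepKernel : Measurable (Function.uncurry stepKernel) := by
  have h : Function.uncurry stepKernel = fun q : ℝ × ℝ =>
      {q : ℝ × ℝ | q.1 ≤ q.2}.indicator (1 : ℝ × ℝ → ℝ) q
        - {q : ℝ × ℝ | 0 ≤ q.2}.indicator (1 : ℝ × ℝ → ℝ) q := by
    ext ⟨y, x⟩
    simp [stepKernel, Function.uncurry, indicator]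
  rw [h]
  exact (measurable_one.indicator (measurableSet_le measurable_fst measurable_snd)).sub
    (measurable_one.indicator (measurableSet_le measurable_const measurable_snd))

lemma integrable_stepKernel (y : ℝ) : Integrable (stepKernel y) := by
  rcases le_total y 0 with hy | hy
  · rw [stepKernel_of_nonpos hy, integrable_indicator_iff measurableSet_Ico]
    exact integrableOn_const (by simp)
  · rw [stepKernel_of_nonneg hy]
    refine Integrable.neg ?_
    rw [integrable_indicator_iff measurableSet_Ico]
    exact integrableOn_const (by simp)

lemma integral_stepKernel_smul (y : ℝ) (c : ℝ → ℂ) :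
    ∫ x, stepKernel y x • c x = ∫ x in y..0, c x := by
  rcases le_total y 0 with hy | hy
  · rw [stepKernel_of_nonpos hy, intervalIntegral.integral_of_le hy,
      ← integral_Ico_eq_integral_Ioc, ← integral_indicator measurableSet_Ico]
    congr 1 with x
    by_cases hx : x ∈ Ico y 0 <;> simp [hx]
  · rw [stepKernel_of_nonneg hy, intervalIntegral.integral_of_ge hy,
      ← integral_Ico_eq_integral_Ioc, ← integral_indicator measurableSet_Ico,
      ← integral_neg]
    congr 1 with x
    by_cases hx : x ∈ Ico 0 y <;> simp [hx]

lemma integral_abs_stepKernel (y : ℝ) : ∫ x, |stepKernel y x| = |y| := by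
  rcases le_total y 0 with hy | hy
  · have : (fun x => |stepKernel y x|) = (Ico y 0).indicator 1 := by
      rw [stepKernel_of_nonpos hy]
      ext x
      by_cases hx : x ∈ Ico y 0 <;> simp [hx]
    rw [this, integral_indicator_one measurableSet_Ico]
    simp [measureReal_def, abs_of_nonpos hy, hy]
  · have : (fun x => |stepKernel y x|) = (Ico 0 y).indicator 1 := by
      rw [stepKernel_of_nonneg hy]
      ext x
      by_cases hx : x ∈ Ico 0 y <;> simp [hx]
    rw [this, integral_indicator_one measurableSet_Ico]
    simp [measureReal_def, abs_of_nonneg hy, hy]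

/-- For fixed `y` the kernel has `L¹` norm `|y|`, so a finite first moment is what Tonelli requires.
-/
lemma integrable_stepKernel_prod {μ : Measure ℝ} [SFinite μ] (hμ : Integrable (fun x => x) μ) :
    Integrable (Function.uncurry stepKernel) (μ.prod volume) := by
  rw [integrable_prod_iff measurable_stepKernel.aestronglyMeasurable]
  refine ⟨.of_forall integrable_stepKernel, ?_⟩
  simpa [Function.uncurry, integral_abs_stepKernel] using hμ.abs

lemma integral_stepKernel_eq {μ : Measure ℝ} [IsProbabilityMeasure μ] (x : ℝ) :
    ∫ y, stepKernel y x ∂μ = cdf μ x - (Ici 0).indicator 1 x := by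
  have h : (fun y => stepKernel y x) =
      fun y => (Iic x).indicator (1 : ℝ → ℝ) y - (Ici (0 : ℝ)).indicator (1 : ℝ → ℝ) x := by
    ext y
    simp [stepKernel, indicator]
  rw [h, integral_sub ((integrable_indicator_iff measurableSet_Iic).2
    (integrableOn_const (by simp))) (integrable_const _), integral_indicator_one measurableSet_Iic,
    cdf_eq_real]
  simp

lemma integrable_cdf_sub_indicator {μ : Measure ℝ} [IsProbabilityMeasure μ]
    (hμ : Integrable (fun x => x) μ) :
    Integrable (fun x => cdf μ x - (Ici (0 : ℝ)).indicator (1 : ℝ → ℝ) x) := by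
  simpa [integral_stepKernel_eq] using (integrable_stepKernel_prod hμ).integral_prod_right

/-- Fubini replaces Stieltjes integration by parts: for fixed `y` the kernel integrates the
exponential between `y` and `0`. Subtracting the unit step makes each distribution function
integrable on its own, and the step cancels in differences. -/
lemma integral_exp_smul_cdf_sub_indicator {μ : Measure ℝ} [IsProbabilityMeasure μ]
    (hμ : Integrable (fun x => x) μ) {t : ℝ} (ht : t ≠ 0) :
    ∫ x, (cdf μ x - (Ici (0 : ℝ)).indicator (1 : ℝ → ℝ) x) • Complex.exp (t * x * Complex.I) =
      (1 - charFun μ t) / (t * Complex.I) := by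
  have hexp : ∀ y : ℝ, ‖Complex.exp (t * y * Complex.I)‖ = 1 := fun y => by
    exact_mod_cast Complex.norm_exp_ofReal_mul_I (t * y)
  have hint : Integrable (fun q : ℝ × ℝ => stepKernel q.1 q.2 •
      Complex.exp (t * q.2 * Complex.I)) (μ.prod volume) := by
    refine (integrable_stepKernel_prod hμ).mono ?_ (.of_forall fun q => ?_)
    · exact (measurable_stepKernel.smul (f := fun q : ℝ × ℝ => stepKernel q.1 q.2)
        (by fun_prop)).aestronglyMeasurable
    · simp [hexp, Function.uncurry]
  have hc : (t * Complex.I : ℂ) ≠ 0 := by simp [ht]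
  calc _ = ∫ x, ∫ y, stepKernel y x • Complex.exp (t * x * Complex.I) ∂μ := by
        simp_rw [integral_smul_const, integral_stepKernel_eq]
    _ = ∫ y, (∫ x, stepKernel y x • Complex.exp (t * x * Complex.I)) ∂μ :=
        (integral_integral_swap hint).symm
    _ = ∫ y, (1 - Complex.exp (t * y * Complex.I)) / (t * Complex.I) ∂μ := by
        congr 1 with y
        rw [integral_stepKernel_smul]
        have := integral_exp_mul_complex (a := y) (b := 0) hc
        simp only [mul_right_comm _ _ Complex.I] at this ⊢
        simpa using this
    _ = _ := by
        rw [integral_div, integral_sub (integrable_const _), charFun_apply_real]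
        · simp
        · refine (integrable_const (1 : ℝ)).mono' (by fun_prop) (.of_forall fun y => (hexp y).le)

/-- At continuity points, the Fourier inversion formula bounds the distance of two distribution
functions. -/
lemma abs_cdf_sub_cdf_le_of_continuousAt {μ ν : Measure ℝ} [IsProbabilityMeasure μ]
    [IsProbabilityMeasure ν] (hμ : Integrable (fun x => x) μ) (hν : Integrable (fun x => x) ν)
    (h : Integrable (fun t : ℝ => ‖charFun μ t - charFun ν t‖ / |t|)) {x : ℝ}
    (hx : ContinuousAt (fun y => cdf μ y - cdf ν y) x) :
    |cdf μ x - cdf ν x| ≤ (2 * π)⁻¹ * ∫ t : ℝ, ‖charFun μ t - charFun ν t‖ / |t| := by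
  set D : ℝ → ℂ := fun y => ((cdf μ y - cdf ν y : ℝ) : ℂ) with hD
  have hKμ := integrable_cdf_sub_indicator hμ
  have hKν := integrable_cdf_sub_indicator hν
  have hDint : Integrable D := by
    refine ((hKμ.sub hKν).congr (.of_forall fun y => ?_)).ofReal
    exact sub_sub_sub_cancel_right _ _ _
  have hpi := Real.pi_pos
  -- The kernel of `𝓕` is `exp(-2πiwy)`, so frequency `w` corresponds to the characteristic function
  -- argument `-2πw`.
  have hF : ∀ w : ℝ, w ≠ 0 → ‖𝓕 D w‖ =
      ‖charFun μ (-(2 * π) * w) - charFun ν (-(2 * π) * w)‖ / |-(2 * π) * w| := by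
    intro w hw
    have ht : -(2 * π) * w ≠ 0 := by simp [hw, hpi.ne']
    have hb : ∀ {f : ℝ → ℝ}, Integrable f → Integrable fun y : ℝ =>
        f y • Complex.exp ((-(2 * π) * w : ℝ) * y * Complex.I) := by
      intro f hf
      refine hf.mono (hf.1.smul (by fun_prop)) (.of_forall fun y => ?_)
      have : ‖Complex.exp ((-(2 * π) * w : ℝ) * y * Complex.I)‖ = 1 := by
        exact_mod_cast Complex.norm_exp_ofReal_mul_I (-(2 * π) * w * y)
      rw [norm_smul, this, mul_one]
    have key : 𝓕 D w = (charFun ν (-(2 * π) * w) - charFun μ (-(2 * π) * w)) /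
        ((-(2 * π) * w : ℝ) * Complex.I) := by
      rw [show charFun ν (-(2 * π) * w) - charFun μ (-(2 * π) * w) =
        (1 - charFun μ (-(2 * π) * w)) - (1 - charFun ν (-(2 * π) * w)) by ring, sub_div,
        ← integral_exp_smul_cdf_sub_indicator hμ ht, ← integral_exp_smul_cdf_sub_indicator hν ht,
        ← integral_sub (hb hKμ) (hb hKν), Real.fourier_real_eq_integral_exp_smul]
      congr 1 with y
      rw [← sub_smul, sub_sub_sub_cancel_right, hD]
      simp only [smul_eq_mul, Complex.real_smul]
      rw [mul_comm]
      congr 2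
      push_cast
      ring
    rw [key, norm_div, norm_mul, Complex.norm_I, mul_one, Complex.norm_real, norm_sub_rev,
      Real.norm_eq_abs]
  have hF' : (fun w => ‖𝓕 D w‖) =ᵐ[volume] fun w : ℝ =>
      ‖charFun μ (-(2 * π) * w) - charFun ν (-(2 * π) * w)‖ / |-(2 * π) * w| := by
    filter_upwards [compl_mem_ae_iff.2 (measure_singleton (0 : ℝ))] with w hw using hF w hw
  have hne : -(2 * π) ≠ 0 := by simp [hpi.ne']
  have hcont : Continuous (𝓕 D) := VectorFourier.fourierIntegral_continuous Real.continuous_fourierChar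
    (by exact continuous_inner) hDint
  have hFint : Integrable (𝓕 D) := by
    rw [← integrable_norm_iff hcont.aestronglyMeasurable]
    exact (h.comp_mul_left' hne).congr hF'.symm
  have hinv := hDint.fourierInv_fourier_eq hFint (v := x)
    (Complex.continuous_ofReal.continuousAt.comp hx)
  calc |cdf μ x - cdf ν x| = ‖𝓕⁻ (𝓕 D) x‖ := by rw [hinv, hD, Complex.norm_real, Real.norm_eq_abs]
    _ ≤ ∫ w, ‖𝓕 D w‖ := by
        rw [Real.fourierInv_eq_fourier_neg]
        exact VectorFourier.norm_fourierIntegral_le_integral_norm _ _ _ _ _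
    _ = ∫ w : ℝ, ‖charFun μ (-(2 * π) * w) - charFun ν (-(2 * π) * w)‖ / |-(2 * π) * w| :=
        integral_congr_ae hF'
    _ = _ := by
        rw [Measure.integral_comp_mul_left (fun t : ℝ => ‖charFun μ t - charFun ν t‖ / |t|)]
        rw [inv_neg, abs_neg, abs_of_pos (by positivity), smul_eq_mul]

/-- The distance of two distribution functions is bounded by the integral of the difference of the
characteristic functions against `1 / |t|`. -/
theorem abs_cdf_sub_cdf_le {μ ν : Measure ℝ} [IsProbabilityMeasure μ]
    [IsProbabilityMeasure ν] (hμ : Integrable (fun x => x) μ) (hν : Integrable (fun x => x) ν)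
    (h : Integrable (fun t : ℝ => ‖charFun μ t - charFun ν t‖ / |t|)) (x : ℝ) :
    |cdf μ x - cdf ν x| ≤ (2 * π)⁻¹ * ∫ t : ℝ, ‖charFun μ t - charFun ν t‖ / |t| := by
  set C : Set ℝ := {y | ContinuousAt (cdf μ) y} ∩ {y | ContinuousAt (cdf ν) y} with hC
  have hdense : Dense C := by
    have hcount : (Cᶜ).Countable := by
      rw [hC, compl_inter]
      exact (monotone_cdf μ).countable_not_continuousAt.union
        (monotone_cdf ν).countable_not_continuousAt
    simpa using hcount.dense_compl ℝ
  -- Common continuity points accumulate at `x` from the right, and distribution functions are right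
  -- continuous, so the bound passes to every `x`.
  have hmem : x ∈ closure (Ioi x ∩ C) := 
    closure_minimal (hdense.open_subset_closure_inter isOpen_Ioi) isClosed_closure (by simp)
  have : (𝓝[Ioi x ∩ C] x).NeBot := mem_closure_iff_nhdsWithin_neBot.1 hmem
  have hlim : Tendsto (fun y => |cdf μ y - cdf ν y|) (𝓝[Ioi x ∩ C] x)
      (𝓝 |cdf μ x - cdf ν x|) := by
    have h1 := ((cdf μ).right_continuous x).mono (Ioi_subset_Ici_self.trans' inter_subset_left
      : Ioi x ∩ C ⊆ Ici x)
    have h2 := ((cdf ν).right_continuous x).mono (Ioi_subset_Ici_self.trans' inter_subset_left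
      : Ioi x ∩ C ⊆ Ici x)
    exact (Tendsto.sub h1 h2).abs
  refine le_of_tendsto hlim ?_
  filter_upwards [self_mem_nhdsWithin] with y hy
  exact abs_cdf_sub_cdf_le_of_continuousAt hμ hν h (hy.2.1.sub hy.2.2)

/-! ### Square integrability of the characteristic function -/

lemma norm_charFun_sq_eq_integral_prod (μ : Measure ℝ) [IsFiniteMeasure μ] (t : ℝ) :
    ((‖charFun μ t‖ ^ 2 : ℝ) : ℂ) =
      ∫ q : ℝ × ℝ, Complex.exp (t * (q.1 - q.2) * Complex.I) ∂(μ.prod μ) := by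
  have h : ∀ q : ℝ × ℝ, Complex.exp (t * (q.1 - q.2) * Complex.I) =
      Complex.exp (t * q.1 * Complex.I) * Complex.exp ((-t : ℝ) * q.2 * Complex.I) := by
    intro q
    rw [← Complex.exp_add]
    congr 1
    push_cast
    ring
  simp_rw [h]
  rw [integral_prod_mul (fun x : ℝ => Complex.exp (t * x * Complex.I))
    (fun x : ℝ => Complex.exp ((-t : ℝ) * x * Complex.I)), ← charFun_apply_real,
    ← charFun_apply_real, charFun_neg, Complex.mul_conj, Complex.normSq_eq_norm_sq]

/-- `|charFun μ|²` is the characteristic function of the difference of two independent copies; by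
Fubini, averaging it over a Gaussian `t` evaluates the Gaussian characteristic function at that
difference. -/
lemma integral_norm_charFun_sq_gaussianReal (μ : Measure ℝ) [IsFiniteMeasure μ] (v : ℝ≥0) :
    ∫ t, ‖charFun μ t‖ ^ 2 ∂(gaussianReal 0 v) =
      ∫ q : ℝ × ℝ, rexp (-(v * (q.1 - q.2) ^ 2 / 2)) ∂(μ.prod μ) := by
  have hint : Integrable (fun z : ℝ × (ℝ × ℝ) =>
      Complex.exp (z.1 * (z.2.1 - z.2.2) * Complex.I)) ((gaussianReal 0 v).prod (μ.prod μ)) := by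
    refine (integrable_const (1 : ℝ)).mono' (by fun_prop) (.of_forall fun z => le_of_eq ?_)
    exact_mod_cast Complex.norm_exp_ofReal_mul_I (z.1 * (z.2.1 - z.2.2))
  rw [← Complex.ofReal_inj, ← integral_complex_ofReal, ← integral_complex_ofReal]
  simp_rw [norm_charFun_sq_eq_integral_prod]
  rw [integral_integral_swap hint]
  congr 1 with q
  have := charFun_gaussianReal (μ := 0) (v := v) (q.1 - q.2)
  rw [charFun_apply_real] at this
  push_cast at this ⊢
  simp_rw [mul_comm _ ((q.1 : ℂ) - q.2)]
  rw [this]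
  congr 1
  ring

/-- A probability measure with density bounded by `A` has a square integrable characteristic
function. -/
theorem lintegral_norm_charFun_sq_le {μ : Measure ℝ} [IsProbabilityMeasure μ] {A : ℝ}
    (hA : 0 ≤ A) (hμ : μ ≤ ENNReal.ofReal A • volume) :
    ∫⁻ t, ENNReal.ofReal (‖charFun μ t‖ ^ 2) ≤ ENNReal.ofReal (2 * π * A) := by
  have hgauss : ∀ v : ℝ≥0, v ≠ 0 → ∀ y : ℝ, ∫⁻ x, ENNReal.ofReal (rexp (-(v * (x - y) ^ 2 / 2))) ∂μ
      ≤ ENNReal.ofReal (A * √(2 * π / v)) := by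
    intro v hv y
    have hv' : (0 : ℝ) < v := by positivity
    calc _ ≤ ∫⁻ x, ENNReal.ofReal (rexp (-(v * (x - y) ^ 2 / 2))) ∂(ENNReal.ofReal A • volume) :=
          lintegral_mono' hμ le_rfl
      _ = ENNReal.ofReal A * ∫⁻ x, ENNReal.ofReal (rexp (-(v * x ^ 2 / 2))) := by
          rw [lintegral_smul_measure, smul_eq_mul]
          congr 1
          exact lintegral_sub_right_eq_self
            (fun x : ℝ => ENNReal.ofReal (rexp (-(v * x ^ 2 / 2)))) y
      _ = _ := by
          have h1 : ∀ x : ℝ, rexp (-(v * x ^ 2 / 2)) = rexp (-(v / 2 : ℝ) * x ^ 2) := fun x => by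
            congr 1; ring
          simp_rw [h1]
          rw [← ofReal_integral_eq_lintegral_ofReal (integrable_exp_neg_mul_sq (by positivity))
            (.of_forall fun x => (exp_pos _).le), integral_gaussian, ENNReal.ofReal_mul hA]
          congr 3
          field_simp
  have hv : ∀ v : ℝ≥0, v ≠ 0 → ∫⁻ t, ENNReal.ofReal (rexp (-(t ^ 2 / (2 * v))) * ‖charFun μ t‖ ^ 2)
      ≤ ENNReal.ofReal (2 * π * A) := by
    intro v hv
    have hv' : (0 : ℝ) < v := by positivity
    have hmeas : Measurable fun t => ENNReal.ofReal (‖charFun μ t‖ ^ 2) := by fun_prop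
    have h1 : ∫⁻ t, ENNReal.ofReal (‖charFun μ t‖ ^ 2) ∂(gaussianReal 0 v) ≤
        ENNReal.ofReal (A * √(2 * π / v)) := by
      have hi1 : Integrable (fun t => ‖charFun μ t‖ ^ 2) (gaussianReal 0 v) := by
        refine (integrable_const (1 : ℝ)).mono' (by fun_prop) (.of_forall fun t => ?_)
        rw [Real.norm_of_nonneg (by positivity)]
        exact pow_le_one₀ (norm_nonneg _) (norm_charFun_le_one t)
      have hi2 : Integrable (fun q : ℝ × ℝ => rexp (-(v * (q.1 - q.2) ^ 2 / 2))) (μ.prod μ) := by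
        refine (integrable_const (1 : ℝ)).mono' (by fun_prop) (.of_forall fun q => ?_)
        rw [Real.norm_of_nonneg (exp_pos _).le, exp_le_one_iff]
        have : 0 ≤ v * (q.1 - q.2) ^ 2 / 2 := by positivity
        linarith
      rw [← ofReal_integral_eq_lintegral_ofReal hi1 (.of_forall fun t => by positivity),
        integral_norm_charFun_sq_gaussianReal, ofReal_integral_eq_lintegral_ofReal hi2
        (.of_forall fun t => (exp_pos _).le), lintegral_prod_symm' _ (by fun_prop)]
      calc _ ≤ ∫⁻ _, ENNReal.ofReal (A * √(2 * π / v)) ∂μ :=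
            lintegral_mono fun y => hgauss v hv y
        _ = _ := by simp
    rw [gaussianReal_of_var_ne_zero _ hv, lintegral_withDensity_eq_lintegral_mul _
      (measurable_gaussianPDF 0 v) hmeas] at h1
    have h2 : ∀ t, ENNReal.ofReal (rexp (-(t ^ 2 / (2 * v))) * ‖charFun μ t‖ ^ 2) =
        ENNReal.ofReal (√(2 * π * v)) *
          (gaussianPDF 0 v * fun t => ENNReal.ofReal (‖charFun μ t‖ ^ 2)) t := by
      intro t
      rw [Pi.mul_apply, gaussianPDF_def, ← ENNReal.ofReal_mul (gaussianPDFReal_nonneg _ _ _),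
        ← ENNReal.ofReal_mul (by positivity), gaussianPDFReal_def]
      congr 1
      have : √(2 * π * v) ≠ 0 := by positivity
      simp only [sub_zero]
      field_simp
    simp_rw [h2]
    rw [lintegral_const_mul _ ((measurable_gaussianPDF 0 v).mul hmeas)]
    grw [h1]
    rw [← ENNReal.ofReal_mul (by positivity)]
    apply ENNReal.ofReal_le_ofReal
    have : √(2 * π * v) * √(2 * π / v) = 2 * π := by
      rw [← Real.sqrt_mul (by positivity), show 2 * π * v * (2 * π / v) = (2 * π) ^ 2 by field_simp,
        Real.sqrt_sq (by positivity)]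
    apply le_of_eq
    linear_combination A * this
  -- The bound in `hv` does not depend on the variance; as `v = k + 1` tends to infinity the weight
  -- tends to `1`, and Fatou's lemma concludes.
  have hlim : ∀ t : ℝ, Tendsto (fun k : ℕ => ENNReal.ofReal
      (rexp (-(t ^ 2 / (2 * ((k + 1 : ℕ) : ℝ≥0)))) * ‖charFun μ t‖ ^ 2)) atTop
      (𝓝 (ENNReal.ofReal (‖charFun μ t‖ ^ 2))) := by
    intro t
    refine ENNReal.tendsto_ofReal ?_
    have h1 : Tendsto (fun k : ℕ => 2 * ((k : ℝ) + 1)) atTop atTop :=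
      (tendsto_atTop_add_const_right _ _ tendsto_natCast_atTop_atTop).const_mul_atTop two_pos
    have h2 := ((continuous_exp.tendsto _).comp (h1.const_div_atTop (t ^ 2)).neg).mul_const
      (‖charFun μ t‖ ^ 2)
    simpa using h2
  calc _ = ∫⁻ t, liminf (fun k : ℕ => ENNReal.ofReal
      (rexp (-(t ^ 2 / (2 * ((k + 1 : ℕ) : ℝ≥0)))) * ‖charFun μ t‖ ^ 2)) atTop := by
        congr 1 with t
        exact (hlim t).liminf_eq.symm
    _ ≤ liminf (fun k : ℕ => ∫⁻ t, ENNReal.ofReal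
      (rexp (-(t ^ 2 / (2 * ((k + 1 : ℕ) : ℝ≥0)))) * ‖charFun μ t‖ ^ 2)) atTop :=
        lintegral_liminf_le fun k => by fun_prop
    _ ≤ liminf (fun _ : ℕ => ENNReal.ofReal (2 * π * A)) atTop :=
        liminf_le_liminf (.of_forall fun k => hv _ (by positivity))
    _ = _ := by simp

lemma integrable_norm_charFun_sq {μ : Measure ℝ} [IsProbabilityMeasure μ] {A : ℝ}
    (hA : 0 ≤ A) (hμ : μ ≤ ENNReal.ofReal A • volume) :
    Integrable (fun t => ‖charFun μ t‖ ^ 2) := by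
  refine ⟨by fun_prop, ?_⟩
  rw [hasFiniteIntegral_iff_ofReal (.of_forall fun t => by positivity)]
  exact (lintegral_norm_charFun_sq_le hA hμ).trans_lt ENNReal.ofReal_lt_top

lemma integral_norm_charFun_sq_le {μ : Measure ℝ} [IsProbabilityMeasure μ] {A : ℝ}
    (hA : 0 ≤ A) (hμ : μ ≤ ENNReal.ofReal A • volume) :
    ∫ t, ‖charFun μ t‖ ^ 2 ≤ 2 * π * A := by
  have := lintegral_norm_charFun_sq_le hA hμ
  rwa [← ofReal_integral_eq_lintegral_ofReal (integrable_norm_charFun_sq hA hμ)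
    (.of_forall fun t => by positivity), ENNReal.ofReal_le_ofReal_iff (by positivity)] at this

/-! ### Characteristic functions away from the origin -/

lemma measureReal_le_mul_volume {μ : Measure ℝ} {A : ℝ}
    (hA : 0 ≤ A) (hμ : μ ≤ ENNReal.ofReal A • volume) {s : Set ℝ} (hs : volume s ≠ ∞) :
    μ.real s ≤ A * volume.real s := by
  have h := hμ s
  rw [Measure.smul_apply, smul_eq_mul] at h
  have := ENNReal.toReal_mono (ENNReal.mul_ne_top ENNReal.ofReal_ne_top hs) h
  rwa [ENNReal.toReal_mul, ENNReal.toReal_ofReal hA] at this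

lemma three_quarters_le_measureReal_Icc {μ : Measure ℝ} [IsProbabilityMeasure μ]
    (hint : Integrable (fun x => x ^ 2) μ) (hvar : ∫ x, x ^ 2 ∂μ ≤ 1) :
    3 / 4 ≤ μ.real (Icc (-2) 2) := by
  have h := mul_meas_ge_le_integral_of_nonneg (μ := μ) (f := fun x => x ^ 2)
    (.of_forall fun x => by positivity) hint 4
  have h2 : μ.real (Icc (-2) 2)ᶜ ≤ μ.real {x | 4 ≤ x ^ 2} := by
    refine measureReal_mono fun x hx => ?_
    by_contra hx'
    simp only [mem_ofPred_eq, not_le] at hx'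
    exact hx ⟨by nlinarith, by nlinarith⟩
  rw [probReal_compl_eq_one_sub measurableSet_Icc] at h2
  linarith

/-- Mass of the set of `x` with `t * x` within `2 * δ` of `θ + 2πℤ`. -/
lemma measureReal_near_period_le {μ : Measure ℝ} [IsProbabilityMeasure μ] {A : ℝ}
    (hA : 0 ≤ A) (hμ : μ ≤ ENNReal.ofReal A • volume) {t : ℝ} (ht : t ≠ 0) (θ : ℝ) {δ R : ℝ}
    (hδ : 0 ≤ δ) (hR : 0 ≤ R) :
    μ.real {x | |x| ≤ R ∧ ∃ k : ℤ, |t * x - θ - 2 * π * k| ≤ 2 * δ} ≤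
      A * (((R * |t| + 2 * δ) / π + 1) * (4 * δ / |t|)) := by
  have hpi := Real.pi_pos
  have ht' : 0 < |t| := abs_pos.2 ht
  set c := R * |t| + 2 * δ with hc
  have hc0 : 0 ≤ c := by positivity
  -- If `|x| ≤ R`, an admissible `k` satisfies `|θ + 2πk| ≤ c`. This leaves an interval of length
  -- `c/π` for `k`, hence at most `c/π + 1` integers, each contributing an interval of length
  -- `4δ/|t|`.
  set K : Finset ℤ := Finset.Icc ⌈(-θ - c) / (2 * π)⌉ ⌊(-θ + c) / (2 * π)⌋ with hK
  have hcard : (K.card : ℝ) ≤ c / π + 1 := by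
    have hint : (K.card : ℤ) ≤ max (⌊(-θ + c) / (2 * π)⌋ + 1 - ⌈(-θ - c) / (2 * π)⌉) 0 := by
      rw [hK, Int.card_Icc, Int.toNat_eq_max]
    have h1 : (K.card : ℝ) ≤
        max ((⌊(-θ + c) / (2 * π)⌋ : ℝ) + 1 - ⌈(-θ - c) / (2 * π)⌉) 0 := by exact_mod_cast hint
    refine h1.trans (max_le ?_ (by positivity))
    have h2 := Int.floor_le ((-θ + c) / (2 * π))
    have h3 := Int.le_ceil ((-θ - c) / (2 * π))
    have h4 : (-θ + c) / (2 * π) - (-θ - c) / (2 * π) = c / π := by field_simp; ring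
    linarith
  have hsub : {x | |x| ≤ R ∧ ∃ k : ℤ, |t * x - θ - 2 * π * k| ≤ 2 * δ} ⊆
      ⋃ k ∈ K, Metric.closedBall ((θ + 2 * π * k) / t) (2 * δ / |t|) := by
    rintro x ⟨hx, k, hk⟩
    have htx : |t * x| ≤ R * |t| := by rw [abs_mul, mul_comm]; gcongr
    refine mem_iUnion₂.2 ⟨k, ?_, ?_⟩
    · rw [hK, Finset.mem_Icc, Int.ceil_le, Int.le_floor, div_le_iff₀ (by positivity),
        le_div_iff₀ (by positivity)]
      rw [abs_le] at hk htx
      constructor <;> nlinarith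
    · rw [Metric.mem_closedBall, Real.dist_eq, le_div_iff₀ ht', ← abs_mul]
      have hx : (x - (θ + 2 * π * k) / t) * t = t * x - θ - 2 * π * k := by
        field_simp
        ring
      rwa [hx]
  have hvol : ∀ k : ℤ, μ.real (Metric.closedBall ((θ + 2 * π * k) / t) (2 * δ / |t|)) ≤
      A * (4 * δ / |t|) := by
    intro k
    refine (measureReal_le_mul_volume hA hμ measure_closedBall_lt_top.ne).trans (le_of_eq ?_)
    rw [measureReal_def, Real.volume_closedBall, ENNReal.toReal_ofReal (by positivity)]
    ring
  calc _ ≤ μ.real (⋃ k ∈ K, Metric.closedBall ((θ + 2 * π * k) / t) (2 * δ / |t|)) :=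
        measureReal_mono hsub (measure_ne_top _ _)
    _ ≤ ∑ k ∈ K, μ.real (Metric.closedBall ((θ + 2 * π * k) / t) (2 * δ / |t|)) :=
        measureReal_biUnion_finset_le _ _
    _ ≤ ∑ k ∈ K, A * (4 * δ / |t|) := Finset.sum_le_sum fun k _ => hvol k
    _ = K.card * (A * (4 * δ / |t|)) := by simp
    _ ≤ (c / π + 1) * (A * (4 * δ / |t|)) := by gcongr
    _ = _ := by ring

/-- Subtracting the nearest multiple of `2π` moves `y` into `[-π, π]`, where `cos y ≤ 1 - 2y²/π²`.
-/
lemma le_one_sub_cos_of_forall_int {y δ : ℝ} (hδ : 0 ≤ δ) (h : ∀ k : ℤ, 2 * δ < |y - 2 * π * k|) :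
    8 * δ ^ 2 / π ^ 2 ≤ 1 - cos y := by
  have hpi := Real.pi_pos
  set k := round (y / (2 * π)) with hk
  have hr := abs_sub_round (y / (2 * π))
  rw [← hk] at hr
  have h1 : y - 2 * π * k = 2 * π * (y / (2 * π) - k) := by field_simp
  have h2 : |y - 2 * π * k| ≤ π := by
    rw [h1, abs_mul, abs_of_pos (by positivity : 0 < 2 * π)]
    nlinarith
  have h3 := cos_le_one_sub_mul_cos_sq h2
  have h4 : cos (y - 2 * π * k) = cos y := by
    rw [mul_comm]; exact Real.cos_sub_int_mul_two_pi y k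
  have h5 : (2 * δ) ^ 2 ≤ (y - 2 * π * k) ^ 2 := by
    rw [← sq_abs (y - 2 * π * k)]
    have := h k
    gcongr
  rw [h4] at h3
  have h6 : 2 / π ^ 2 * (2 * δ) ^ 2 ≤ 2 / π ^ 2 * (y - 2 * π * k) ^ 2 := by gcongr
  have h7 : 2 / π ^ 2 * (2 * δ) ^ 2 = 8 * δ ^ 2 / π ^ 2 := by ring
  linarith

lemma exists_norm_charFun_eq_integral_cos (μ : Measure ℝ) [IsFiniteMeasure μ] (t : ℝ) :
    ∃ θ : ℝ, ‖charFun μ t‖ = ∫ x, cos (t * x - θ) ∂μ := by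
  refine ⟨(charFun μ t).arg, ?_⟩
  set θ := (charFun μ t).arg with hθ
  have hint : Integrable (fun x : ℝ => Complex.exp ((t * x - θ : ℝ) * Complex.I)) μ := by
    refine (integrable_const (1 : ℝ)).mono' (by fun_prop) (.of_forall fun x => ?_)
    rw [Complex.norm_exp_ofReal_mul_I]
  have h1 : (‖charFun μ t‖ : ℂ) = ∫ x, Complex.exp ((t * x - θ : ℝ) * Complex.I) ∂μ := by
    have h2 : ∀ x : ℝ, Complex.exp ((t * x - θ : ℝ) * Complex.I) =
        Complex.exp (t * x * Complex.I) * Complex.exp (-(θ * Complex.I)) := fun x => by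
      rw [← Complex.exp_add]; congr 1; push_cast; ring
    simp_rw [h2]
    rw [integral_mul_const, ← charFun_apply_real]
    conv_rhs => rw [← Complex.norm_mul_exp_arg_mul_I (charFun μ t)]
    rw [mul_assoc, ← Complex.exp_add]
    simp [hθ]
  have h3 := congrArg Complex.re h1
  rw [Complex.ofReal_re] at h3
  rw [h3, ← RCLike.re_eq_complex_re, ← integral_re hint]
  congr 1 with x
  rw [RCLike.re_eq_complex_re, Complex.exp_ofReal_mul_I_re]

/-- Away from the origin, the characteristic function of a normalized law with density bounded by
`A` is bounded away from one. -/
theorem norm_charFun_le_exp {μ : Measure ℝ} [IsProbabilityMeasure μ] {A : ℝ}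
    (hA : 0 ≤ A) (hμ : μ ≤ ENNReal.ofReal A • volume)
    (hint : Integrable (fun x => x ^ 2) μ) (hvar : ∫ x, x ^ 2 ∂μ ≤ 1) {t : ℝ} (ht : 3 ≤ t ^ 2) :
    ‖charFun μ t‖ ≤ rexp (-(1 / (96 * A ^ 2 * (2 + π) ^ 2))) := by
  have hpi := Real.pi_gt_three
  have hM := three_quarters_le_measureReal_Icc hint hvar
  have hA' : 3 / 16 ≤ A := by
    have := measureReal_le_mul_volume hA hμ (s := Icc (-2) 2) (by simp)
    rw [measureReal_def volume, Real.volume_Icc, ENNReal.toReal_ofReal (by norm_num)] at this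
    linarith
  have hA0 : 0 < A := by linarith
  have ht0 : t ≠ 0 := by rintro rfl; norm_num at ht
  have htabs : 17 / 10 ≤ |t| := by
    by_contra! h
    have := abs_nonneg t
    rw [← sq_abs] at ht
    nlinarith
  obtain ⟨θ, hθ⟩ := exists_norm_charFun_eq_integral_cos μ t
  -- With this `δ` the set `B`, where `cos (t x - θ)` may be near `1`, has mass at most `7/20`.
  -- Chebyshev's `3/4` on `[-2, 2]` then leaves mass `2/5` on which `1 - cos` is at least `8δ²/π²`,
  -- so `1 - ‖charFun μ t‖ ≥ 1/(80A²π²)`.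
  set δ := 1 / (16 * A) with hδ
  have hδ0 : 0 < δ := by positivity
  have hAδ : A * δ = 1 / 16 := by rw [hδ]; field_simp
  have hδ3 : δ ≤ 1 / 3 := by
    rw [hδ, div_le_div_iff₀ (by positivity) (by norm_num)]; linarith
  set B := {x | |x| ≤ 2 ∧ ∃ k : ℤ, |t * x - θ - 2 * π * k| ≤ 2 * δ} with hB
  have hBm : μ.real B ≤ 7 / 20 := by
    refine (measureReal_near_period_le hA hμ ht0 θ hδ0.le zero_le_two).trans ?_
    have h1 : A * (((2 * |t| + 2 * δ) / π + 1) * (4 * δ / |t|)) =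
        (A * δ) * 4 * (2 / π + (2 * δ / π + 1) * (1 / |t|)) := by
      have : |t| ≠ 0 := abs_ne_zero.2 ht0
      field_simp
      ring
    have h2 : 2 / π ≤ 2 / 3 := by gcongr
    have h3 : 2 * δ / π ≤ 2 / 9 := by
      rw [div_le_div_iff₀ (by positivity) (by norm_num)]; nlinarith
    have h4 : 1 / |t| ≤ 10 / 17 := by
      rw [div_le_div_iff₀ (by positivity) (by norm_num)]; linarith
    have h5 : (2 * δ / π + 1) * (1 / |t|) ≤ (2 / 9 + 1) * (10 / 17) := by gcongr
    rw [h1, hAδ]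
    linarith
  have hG : 2 / 5 ≤ μ.real (Icc (-2) 2 \ B) := by
    have := le_measureReal_sdiff (μ := μ) (s₁ := Icc (-2) 2) (s₂ := B)
    linarith
  have hcosint : Integrable (fun x => 1 - cos (t * x - θ)) μ := by
    refine (integrable_const (2 : ℝ)).mono' (by fun_prop) (.of_forall fun x => ?_)
    rw [Real.norm_eq_abs, abs_le]
    have h1 := Real.neg_one_le_cos (t * x - θ)
    have h2 := Real.cos_le_one (t * x - θ)
    constructor <;> linarith
  set ε := 8 * δ ^ 2 / π ^ 2 with hε
  have hmark := mul_meas_ge_le_integral_of_nonneg (μ := μ) (f := fun x => 1 - cos (t * x - θ))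
    (.of_forall fun x => sub_nonneg.2 (Real.cos_le_one _)) hcosint ε
  have hsub : μ.real (Icc (-2) 2 \ B) ≤ μ.real {x | ε ≤ 1 - cos (t * x - θ)} := by
    refine measureReal_mono fun x hx => ?_
    refine le_one_sub_cos_of_forall_int hδ0.le fun k => ?_
    by_contra! hk
    exact hx.2 ⟨abs_le.2 hx.1, k, hk⟩
  have hval : ∫ x, (1 - cos (t * x - θ)) ∂μ = 1 - ‖charFun μ t‖ := by
    have hc : Integrable (fun x => cos (t * x - θ)) μ := by
      refine (integrable_const (1 : ℝ)).mono' (by fun_prop) (.of_forall fun x => ?_)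
      exact Real.abs_cos_le_one _
    rw [integral_sub (integrable_const _) hc, hθ]
    simp
  have hfin : 1 / (96 * A ^ 2 * (2 + π) ^ 2) ≤ ε * (2 / 5) := by
    have h1 : ε * (2 / 5) = 1 / (80 * A ^ 2 * π ^ 2) := by
      rw [hε, hδ]
      field_simp
      norm_num
    rw [h1]
    gcongr <;> linarith
  have hε0 : 0 ≤ ε := by positivity
  have h1 : ε * (2 / 5) ≤ 1 - ‖charFun μ t‖ := by
    rw [← hval]
    refine le_trans ?_ hmark
    gcongr
    exact hG.trans hsub
  have h2 := Real.add_one_le_exp (-(1 / (96 * A ^ 2 * (2 + π) ^ 2)))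
  linarith

/-! ### Taylor remainders of the exponential on the imaginary axis -/

lemma norm_exp_mul_sub_sum_le {a : ℂ} (ha : a.re = 0) (ha' : ‖a‖ ≤ 1) (n : ℕ) :
    ∀ u : ℝ, 0 ≤ u → ‖Complex.exp (a * u) - ∑ k ∈ Finset.range n, (a * u) ^ k / k.factorial‖ ≤
      u ^ n / n.factorial := by
  induction n with
  | zero =>
    intro u hu
    simp [Complex.norm_exp, ha]
  | succ n ih =>
    intro u hu
    set f : ℝ → ℂ := fun v => Complex.exp (a * v) -
      ∑ k ∈ Finset.range (n + 1), (a * v) ^ k / k.factorial with hf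
    -- The derivative of one remainder is `a` times the preceding one, so the induction integrates
    -- the bound from `0`.
    have hder : ∀ v : ℝ, HasDerivAt f (a * (Complex.exp (a * v) -
        ∑ k ∈ Finset.range n, (a * v) ^ k / k.factorial)) v := by
      intro v
      have hlin : HasDerivAt (fun v : ℝ => a * (v : ℂ)) a v := by
        simpa using (Complex.ofRealCLM.hasDerivAt (x := v)).const_mul a
      have hpow : ∀ k ∈ Finset.range (n + 1), HasDerivAt
          (fun v : ℝ => (a * (v : ℂ)) ^ k / (k.factorial : ℂ))
          (k * (a * v) ^ (k - 1) * a / k.factorial) v :=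
        fun k _ => (hlin.pow k).div_const _
      have h := hlin.cexp.sub (HasDerivAt.fun_sum hpow)
      refine h.congr_deriv ?_
      symm
      rw [Finset.sum_range_succ', mul_sub, Finset.mul_sum]
      have : ∀ k ∈ Finset.range n, a * ((a * v) ^ k / (k.factorial : ℂ)) =
          ((k + 1 : ℕ) : ℂ) * (a * v) ^ (k + 1 - 1) * a / ((k + 1).factorial : ℂ) := by
        intro k _
        have h1 : (k.factorial : ℂ) ≠ 0 := by exact_mod_cast k.factorial_ne_zero
        have h2 : ((k + 1 : ℕ) : ℂ) ≠ 0 := by exact_mod_cast k.succ_ne_zero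
        rw [Nat.factorial_succ, Nat.cast_mul, Nat.add_sub_cancel]
        field_simp
      rw [Finset.sum_congr rfl this]
      simp
      ring
    have hB : ∀ v : ℝ, HasDerivAt (fun v : ℝ => v ^ (n + 1) / ((n + 1).factorial : ℝ))
        (v ^ n / n.factorial) v := by
      intro v
      have h := (hasDerivAt_pow (n + 1) v).div_const ((n + 1).factorial : ℝ)
      refine h.congr_deriv ?_
      rw [Nat.factorial_succ]
      push_cast
      field_simp
    refine image_norm_le_of_norm_deriv_right_le_deriv_boundary (a := 0) (b := u) (f := f)
      (fun v _ => (hder v).continuousAt.continuousWithinAt)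
      (fun v _ => (hder v).hasDerivWithinAt) ?_ (B := fun v => v ^ (n + 1) / (n + 1).factorial)
      (B' := fun v => v ^ n / n.factorial) hB ?_ ⟨hu, le_rfl⟩
    · simp [hf, Finset.sum_range_succ']
    · intro v hv
      rw [norm_mul]
      calc _ ≤ 1 * ‖Complex.exp (a * v) - ∑ k ∈ Finset.range n, (a * v) ^ k / k.factorial‖ := by
            gcongr
        _ ≤ _ := by rw [one_mul]; exact ih v hv.1

lemma norm_exp_mul_I_sub_sum_le (n : ℕ) (y : ℝ) :
    ‖Complex.exp (y * Complex.I) - ∑ k ∈ Finset.range n, (y * Complex.I) ^ k / k.factorial‖ ≤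
      |y| ^ n / n.factorial := by
  rcases le_total 0 y with hy | hy
  · have := norm_exp_mul_sub_sum_le (a := Complex.I) (by simp) (by simp) n y hy
    rwa [abs_of_nonneg hy, mul_comm (y : ℂ)]
  · have := norm_exp_mul_sub_sum_le (a := -Complex.I) (by simp) (by simp) n (-y) (by linarith)
    rw [abs_of_nonpos hy]
    rwa [Complex.ofReal_neg, neg_mul_neg, mul_comm Complex.I] at this

lemma norm_exp_mul_I_sub_sum_le_two (n : ℕ) (y : ℝ) :
    ‖Complex.exp (y * Complex.I) - ∑ k ∈ Finset.range (n + 1), (y * Complex.I) ^ k / k.factorial‖ ≤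
      2 * (|y| ^ n / n.factorial) := by
  rw [Finset.sum_range_succ, ← sub_sub]
  refine (norm_sub_le _ _).trans ?_
  rw [two_mul]
  gcongr
  · exact norm_exp_mul_I_sub_sum_le n y
  · simp

/-! ### Comparison of characteristic functions with matching moments -/

section SignedDifference

variable {μ ν : Measure ℝ} [IsFiniteMeasure μ] [IsFiniteMeasure ν]

lemma variation_toSignedMeasure_sub_le :
    (μ.toSignedMeasure - ν.toSignedMeasure).variation ≤ μ + ν := by
  simpa using VectorMeasure.variation_sub_le (μ := μ.toSignedMeasure) (ν := ν.toSignedMeasure)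

lemma norm_integral_sub_integral_le {E : Type*} [NormedAddCommGroup E] [NormedSpace ℝ E]
    [CompleteSpace E] {h : ℝ → E} (hμ : Integrable h μ) (hν : Integrable h ν) :
    ‖∫ x, h x ∂μ - ∫ x, h x ∂ν‖ ≤
      ∫ x, ‖h x‖ ∂(μ.toSignedMeasure - ν.toSignedMeasure).variation := by
  have h1 := VectorMeasure.integral_sub_vectorMeasure (μ := μ.toSignedMeasure)
    (ν := ν.toSignedMeasure) (f := h) (B := (ContinuousLinearMap.lsmul ℝ ℝ).flip)
    (by rwa [VectorMeasure.Integrable, Measure.variation_toSignedMeasure])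
    (by rwa [VectorMeasure.Integrable, Measure.variation_toSignedMeasure])
  rw [VectorMeasure.integral_toSignedMeasure, VectorMeasure.integral_toSignedMeasure] at h1
  rw [← h1]
  refine VectorMeasure.norm_integral_le_integral_norm.trans ?_
  refine mul_le_of_le_one_left (integral_nonneg fun _ => norm_nonneg _) ?_
  rw [ContinuousLinearMap.opNorm_flip]
  exact ContinuousLinearMap.opNorm_lsmul_le

/-- If the moments up to order `m` of two measures agree, then the difference of the characteristic
functions is controlled by the truncated absolute moments of the difference measure. -/
theorem norm_charFun_sub_charFun_le {m : ℕ} (hμ : ∀ k ≤ m, Integrable (fun x => x ^ k) μ)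
    (hν : ∀ k ≤ m, Integrable (fun x => x ^ k) ν)
    (heq : ∀ k ≤ m, ∫ x, x ^ k ∂μ = ∫ x, x ^ k ∂ν) (c t : ℝ) :
    ‖charFun μ t - charFun ν t‖ ≤
      |t| ^ (m + 1) / (m + 1).factorial * (∫ x in {x : ℝ | |x| ≤ c}, |x| ^ (m + 1)
        ∂(μ.toSignedMeasure - ν.toSignedMeasure).variation) +
      2 * (|t| ^ m / m.factorial) * (∫ x in {x : ℝ | c < |x|}, |x| ^ m
        ∂(μ.toSignedMeasure - ν.toSignedMeasure).variation) := by
  set V := (μ.toSignedMeasure - ν.toSignedMeasure).variation with hV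
  have hVle : V ≤ μ + ν := variation_toSignedMeasure_sub_le
  have : IsFiniteMeasure V := isFiniteMeasure_of_le _ hVle
  set p : ℝ → ℂ := fun x => ∑ k ∈ Finset.range (m + 1), (t * x * Complex.I) ^ k / k.factorial
    with hp
  have hterm : ∀ {ρ : Measure ℝ}, ∀ k, Integrable (fun x : ℝ => x ^ k) ρ →
      Integrable (fun x : ℝ => (t * x * Complex.I) ^ k / (k.factorial : ℂ)) ρ := by
    intro ρ k hk
    refine (hk.ofReal.const_mul ((t * Complex.I) ^ k / (k.factorial : ℂ))).congr
      (.of_forall fun x => ?_)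
    simp only [RCLike.ofReal_pow, Complex.coe_algebraMap]
    ring
  have hpint : ∀ {ρ : Measure ℝ}, (∀ k ≤ m, Integrable (fun x => x ^ k) ρ) → Integrable p ρ :=
    fun h => integrable_finsetSum _ fun k hk => hterm k (h k (Finset.mem_range_succ_iff.1 hk))
  have hpval : ∀ {ρ : Measure ℝ}, (∀ k ≤ m, Integrable (fun x => x ^ k) ρ) → ∫ x, p x ∂ρ =
      ∑ k ∈ Finset.range (m + 1), (t * Complex.I) ^ k / k.factorial * ((∫ x, x ^ k ∂ρ : ℝ) : ℂ) := by
    intro ρ h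
    rw [hp, integral_finsetSum _ fun k hk => hterm k (h k (Finset.mem_range_succ_iff.1 hk))]
    refine Finset.sum_congr rfl fun k _ => ?_
    rw [← integral_complex_ofReal, ← integral_const_mul]
    congr 1 with x
    push_cast
    ring
  have hexp : ∀ {ρ : Measure ℝ} [IsFiniteMeasure ρ],
      Integrable (fun x : ℝ => Complex.exp (t * x * Complex.I)) ρ := by
    intro ρ _
    refine (integrable_const (1 : ℝ)).mono' (by fun_prop) (.of_forall fun x => le_of_eq ?_)
    exact_mod_cast Complex.norm_exp_ofReal_mul_I (t * x)
  -- Equal moments cancel the whole Taylor polynomial, even where only the remainder of order `m` is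
  -- used afterwards.
  have hpeq : ∫ x, p x ∂μ = ∫ x, p x ∂ν := by
    rw [hpval hμ, hpval hν]
    refine Finset.sum_congr rfl fun k hk => ?_
    rw [heq k (Finset.mem_range_succ_iff.1 hk)]
  set h : ℝ → ℂ := fun x => Complex.exp (t * x * Complex.I) - p x with hh
  have hhμ : Integrable h μ := hexp.sub (hpint hμ)
  have hhν : Integrable h ν := hexp.sub (hpint hν)
  have hhV : Integrable h V := (hhμ.add_measure hhν).mono_measure hVle
  have hxV : Integrable (fun x => |x| ^ m) V := by
    have := (((hμ m le_rfl).add_measure (hν m le_rfl)).mono_measure hVle).abs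
    simpa [abs_pow] using this
  have hdiff : charFun μ t - charFun ν t = ∫ x, h x ∂μ - ∫ x, h x ∂ν := by
    rw [hh, integral_sub hexp (hpint hμ), integral_sub hexp (hpint hν), charFun_apply_real,
      charFun_apply_real, hpeq]
    ring
  have hS : MeasurableSet {x : ℝ | |x| ≤ c} := measurableSet_le (by fun_prop) (by fun_prop)
  have hSc : {x : ℝ | |x| ≤ c}ᶜ = {x : ℝ | c < |x|} := by ext x; simp
  rw [hdiff]
  refine (norm_integral_sub_integral_le hhμ hhν).trans ?_
  rw [← hV, ← integral_add_compl hS hhV.norm, hSc]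
  have htx : ∀ x : ℝ, (t : ℂ) * x * Complex.I = ((t * x : ℝ) : ℂ) * Complex.I := fun x => by
    push_cast; ring
  refine add_le_add ?_ ?_
  · rw [← integral_const_mul]
    refine integral_mono_of_nonneg (.of_forall fun x => norm_nonneg _) ?_ (.of_forall fun x => ?_)
    · refine Integrable.const_mul ?_ _
      refine (integrable_const (|c| ^ (m + 1))).mono' (by fun_prop) ?_
      filter_upwards [ae_restrict_mem hS] with x hx
      rw [Real.norm_of_nonneg (by positivity)]
      exact pow_le_pow_left₀ (abs_nonneg _) (le_trans hx (le_abs_self c)) _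
    · have := norm_exp_mul_I_sub_sum_le (m + 1) (t * x)
      simp only [hh, hp, htx]
      refine this.trans (le_of_eq ?_)
      rw [abs_mul, mul_pow]
      ring
  · rw [← integral_const_mul]
    refine integral_mono_of_nonneg (.of_forall fun x => norm_nonneg _)
      (hxV.integrableOn.const_mul _) (.of_forall fun x => ?_)
    have := norm_exp_mul_I_sub_sum_le_two m (t * x)
    simp only [hh, hp, htx]
    refine this.trans (le_of_eq ?_)
    rw [abs_mul, mul_pow]
    ring

end SignedDifference

/-! ### Power terms against a Gaussian exponential -/

lemma mul_factorial_le_pow_mul_factorial {k : ℕ} (hk : 2 ≤ k) :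
    27 / 16 * (k.factorial : ℝ) ≤ (3 / 8) ^ k * ((2 * k).factorial : ℝ) := by
  induction k, hk using Nat.le_induction with
  -- Both sides equal `27/8` here, which is why the constant is `27/16`.
  | base => norm_num [Nat.factorial]
  | succ k hk ih =>
    have h1 : ((2 * (k + 1)).factorial : ℝ) = (2 * k + 2) * ((2 * k + 1) * (2 * k).factorial) := by
      rw [show 2 * (k + 1) = 2 * k + 1 + 1 by ring, Nat.factorial_succ, Nat.factorial_succ]
      push_cast
      ring
    have h2 : (((k + 1).factorial : ℕ) : ℝ) = (k + 1) * k.factorial := by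
      rw [Nat.factorial_succ]; push_cast; ring
    have hk' : (2 : ℝ) ≤ k := by exact_mod_cast hk
    rw [h1, h2, pow_succ]
    calc 27 / 16 * ((k + 1) * (k.factorial : ℝ)) = (k + 1) * (27 / 16 * k.factorial) := by ring
      _ ≤ (k + 1) * ((3 / 8) ^ k * ((2 * k).factorial : ℝ)) := by gcongr
      _ ≤ (3 / 8 * (2 * k + 2) * (2 * k + 1)) * ((3 / 8) ^ k * ((2 * k).factorial : ℝ)) := by
          gcongr
          nlinarith
      _ = _ := by ring

lemma pow_div_factorial_le {k : ℕ} (hk : 2 ≤ k) (s : ℝ) :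
    27 / 16 * (s ^ (2 * k) / (2 * k).factorial) ≤ (3 * s ^ 2 / 8) ^ k / k.factorial := by
  have h := mul_factorial_le_pow_mul_factorial hk
  have h1 : (0 : ℝ) < k.factorial := by positivity
  have h2 : (0 : ℝ) < (2 * k).factorial := by positivity
  have h3 : 0 ≤ s ^ (2 * k) := by rw [pow_mul]; positivity
  rw [← mul_div_assoc, div_le_div_iff₀ h2 h1,
    show 3 * s ^ 2 / 8 = 3 / 8 * s ^ 2 by ring, mul_pow, ← pow_mul]
  calc _ = s ^ (2 * k) * (27 / 16 * k.factorial) := by ring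
    _ ≤ s ^ (2 * k) * ((3 / 8) ^ k * ((2 * k).factorial : ℝ)) := by gcongr
    _ = _ := by ring

lemma pow_div_factorial_add_le_exp_sub_one {k : ℕ} (hk : 1 ≤ k) {a : ℝ} (ha : 0 ≤ a) :
    a ^ k / k.factorial + a ^ (k + 1) / (k + 1).factorial ≤ rexp a - 1 := by
  have h := Real.sum_le_exp_of_nonneg ha (k + 2)
  obtain ⟨j, rfl⟩ : ∃ j, k = j + 1 := ⟨k - 1, by omega⟩
  rw [Finset.sum_range_succ, Finset.sum_range_succ, Finset.sum_range_succ'] at h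
  have h0 : 0 ≤ ∑ i ∈ Finset.range j, a ^ (i + 1) / ((i + 1).factorial : ℝ) :=
    Finset.sum_nonneg fun i _ => by positivity
  simp only [pow_zero, Nat.factorial_zero, Nat.cast_one, div_one] at h
  linarith

/-- The left side is the Taylor bound for `f - g` with both pseudomoments replaced by `ν`. Odd
powers are traded for neighbouring even ones by the arithmetic-geometric mean inequality, and even
powers of `s` are compared with two consecutive terms of the series of `exp (3s²/8)`. -/
lemma two_mul_pow_div_factorial_add_le {m : ℕ} (hm : 3 ≤ m) {s : ℝ} (hs : 0 ≤ s) :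
    2 * (s ^ m / m.factorial) + s ^ (m + 1) / (m + 1).factorial ≤
      2 * (rexp (3 * s ^ 2 / 8) - 1) := by
  have key : ∀ k : ℕ, 1 ≤ k → s ^ (2 * k + 1) / ((2 * k + 1).factorial : ℝ) ≤
      1 / 2 * (s ^ (2 * k) / (2 * k).factorial) +
        2 / 3 * (s ^ (2 * k + 2) / (2 * k + 2).factorial) := by
    intro k hk
    have hk' : (1 : ℝ) ≤ k := by exact_mod_cast hk
    set P := s ^ (2 * k) / ((2 * k).factorial : ℝ) with hP
    have hP0 : 0 ≤ P := by positivity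
    have hf : ((2 * k).factorial : ℝ) ≠ 0 := by positivity
    have hM : s ^ (2 * k + 1) / ((2 * k + 1).factorial : ℝ) = P * (s / (2 * k + 1)) := by
      rw [hP, Nat.factorial_succ, pow_succ]
      push_cast
      field_simp
    have hQ : s ^ (2 * k + 2) / ((2 * k + 2).factorial : ℝ) =
        P * (s / (2 * k + 1)) ^ 2 * ((2 * k + 1) / (2 * k + 2)) := by
      rw [hP, Nat.factorial_succ, Nat.factorial_succ, pow_add]
      push_cast
      field_simp
      ring
    have hr : 3 / 4 ≤ (2 * (k : ℝ) + 1) / (2 * k + 2) := by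
      rw [div_le_div_iff₀ (by norm_num) (by positivity)]
      linarith
    rw [hM, hQ]
    set r := s / (2 * (k : ℝ) + 1)
    have h1 : P * r ^ 2 * (3 / 4) ≤ P * r ^ 2 * ((2 * (k : ℝ) + 1) / (2 * k + 2)) := by gcongr
    nlinarith [mul_nonneg hP0 (sq_nonneg (1 - r))]
  have hP0 : ∀ k, 0 ≤ s ^ k / (k.factorial : ℝ) := fun k => by positivity
  have ha : 0 ≤ 3 * s ^ 2 / 8 := by positivity
  rcases Nat.even_or_odd' m with ⟨k, rfl | rfl⟩
  · have h1 := key k (by omega)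
    have h2 := pow_div_factorial_le (k := k) (by omega) s
    have h3 := pow_div_factorial_le (k := k + 1) (by omega) s
    have h4 := pow_div_factorial_add_le_exp_sub_one (k := k) (by omega) ha
    rw [show 2 * (k + 1) = 2 * k + 2 by ring] at h3
    linarith [hP0 (2 * k), hP0 (2 * k + 2)]
  · have h1 := key k (by omega)
    -- The factor `27/16` is not available for `k = 1`, that is `m = 3`; there `3/4` gives equality
    -- and still suffices.
    have h2 : 3 / 4 * (s ^ (2 * k) / ((2 * k).factorial : ℝ)) ≤
        (3 * s ^ 2 / 8) ^ k / k.factorial := by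
      rcases (show 1 ≤ k by omega).eq_or_lt with rfl | hk
      · norm_num [Nat.factorial]
        linarith
      · linarith [pow_div_factorial_le (k := k) hk s, hP0 (2 * k)]
    have h3 := pow_div_factorial_le (k := k + 1) (by omega) s
    have h4 := pow_div_factorial_add_le_exp_sub_one (k := k) (by omega) ha
    rw [show 2 * (k + 1) = 2 * k + 2 by ring] at h3
    rw [show 2 * k + 1 + 1 = 2 * k + 2 by ring]
    linarith [hP0 (2 * k), hP0 (2 * k + 2)]

/-! ### Pointwise bounds for `n`-th powers and their integrals -/

lemma norm_pow_sub_pow_le {a b : ℂ} {M : ℝ} (ha : ‖a‖ ≤ M) (hb : ‖b‖ ≤ M) (n : ℕ) :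
    ‖a ^ n - b ^ n‖ ≤ n * ‖a - b‖ * M ^ (n - 1) := by
  rw [← geom_sum₂_mul, norm_mul]
  have hM : 0 ≤ M := (norm_nonneg a).trans ha
  have h : ‖∑ i ∈ Finset.range n, a ^ i * b ^ (n - 1 - i)‖ ≤ n * M ^ (n - 1) := by
    calc _ ≤ ∑ i ∈ Finset.range n, M ^ (n - 1) := by
          refine norm_sum_le_of_le _ fun i hi => ?_
          rw [norm_mul, norm_pow, norm_pow]
          calc _ ≤ M ^ i * M ^ (n - 1 - i) := by gcongr
            _ = M ^ (n - 1) := by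
              rw [← pow_add]; congr 1; have := Finset.mem_range.1 hi; omega
      _ = _ := by simp
  nlinarith [norm_nonneg (a - b)]

/-- The absolute moments of a Gaussian weight. -/
lemma integral_abs_pow_mul_exp_neg_mul_sq (k : ℕ) {b : ℝ} (hb : 0 < b) :
    ∫ x : ℝ, |x| ^ k * rexp (-b * x ^ 2) =
      b ^ (-((k : ℝ) + 1) / 2) * Gamma (((k : ℝ) + 1) / 2) := by
  have h1 := integral_comp_abs (f := fun x : ℝ => x ^ k * rexp (-b * x ^ 2))
  have h2 := integral_rpow_mul_exp_neg_mul_rpow (p := 2) (q := k) two_pos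
    (by have : (0 : ℝ) ≤ k := by positivity
        linarith) hb
  simp only [rpow_natCast, rpow_two] at h2
  simp only [sq_abs] at h1
  rw [h1, h2]
  ring

lemma integrable_abs_pow_mul_exp_neg_mul_sq (k : ℕ) {b : ℝ} (hb : 0 < b) :
    Integrable fun x : ℝ => |x| ^ k * rexp (-b * x ^ 2) := by
  have := (integrable_rpow_mul_exp_neg_mul_sq hb (s := k)
    (by have : (0 : ℝ) ≤ k := by positivity
        linarith)).norm
  simpa [abs_mul, abs_pow] using this

/-- Pointwise bound for the difference of the `n`-th powers of a characteristic function and of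
the Gaussian one: the first summand covers the `t` with `2 ν ≤ exp (-t² / 2)`, the others the
remaining ones. -/
lemma norm_pow_sub_exp_div_le {f : ℝ → ℂ} {m n : ℕ} (hm : 3 ≤ m) (hn : 3 ≤ n) {ν₁ ν₂ ν b : ℝ}
    (hν₁ : 0 ≤ ν₁) (hν₂ : 0 ≤ ν₂) (hν₁' : ν₁ ≤ ν) (hν₂' : ν₂ ≤ ν)
    (hν : ν < 1 / 2 * rexp (-(3 / 2))) (hb : 0 ≤ b)
    (hdiff : ∀ t : ℝ, ‖f t - (rexp (-(t ^ 2 / 2)) : ℂ)‖ ≤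
      |t| ^ (m + 1) / (m + 1).factorial * ν₁ + 2 * (|t| ^ m / m.factorial) * ν₂)
    (htail : ∀ t : ℝ, 3 ≤ t ^ 2 → ‖f t‖ ≤ b) (t : ℝ) :
    ‖f t ^ n - (rexp (-(t ^ 2 / 2)) : ℂ) ^ n‖ / |t| ≤
      (n * ν₁ / (m + 1).factorial * (|t| ^ m * rexp (-(n / 12 : ℝ) * t ^ 2)) +
        2 * n * ν₂ / m.factorial * (|t| ^ (m - 1) * rexp (-(n / 12 : ℝ) * t ^ 2))) +
      (b ^ (n - 2) * ‖f t‖ ^ 2 +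
        2 * ν * rexp (-(3 / 2)) ^ (n - 2) * (|t| ^ 1 * rexp (-(1 / 2 : ℝ) * t ^ 2))) := by
  have hν0 : 0 ≤ ν := hν₁.trans hν₁'
  have hnorm : ‖(rexp (-(t ^ 2 / 2)) : ℂ)‖ = rexp (-(t ^ 2 / 2)) := by
    rw [Complex.norm_real, Real.norm_of_nonneg (exp_pos _).le]
  rcases eq_or_ne t 0 with rfl | ht
  · rw [abs_zero, div_zero]
    positivity
  have ht' : 0 < |t| := abs_pos.2 ht
  rw [div_le_iff₀ ht']
  rcases le_or_gt (2 * ν) (rexp (-(t ^ 2 / 2))) with hcase | hcase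
  · have hle : ‖f t - (rexp (-(t ^ 2 / 2)) : ℂ)‖ ≤
        rexp (-(t ^ 2 / 8)) - rexp (-(t ^ 2 / 2)) := by
      have h1 := two_mul_pow_div_factorial_add_le hm (abs_nonneg t)
      rw [sq_abs] at h1
      have h2 : 0 ≤ rexp (3 * t ^ 2 / 8) - 1 := by
        have := Real.add_one_le_exp (3 * t ^ 2 / 8)
        have : 0 ≤ 3 * t ^ 2 / 8 := by positivity
        linarith
      calc _ ≤ |t| ^ (m + 1) / (m + 1).factorial * ν + 2 * (|t| ^ m / m.factorial) * ν := by
            refine (hdiff t).trans ?_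
            gcongr
        _ = (2 * (|t| ^ m / m.factorial) + |t| ^ (m + 1) / (m + 1).factorial) * ν := by ring
        _ ≤ (2 * (rexp (3 * t ^ 2 / 8) - 1)) * ν := by gcongr
        _ = (rexp (3 * t ^ 2 / 8) - 1) * (2 * ν) := by ring
        _ ≤ (rexp (3 * t ^ 2 / 8) - 1) * rexp (-(t ^ 2 / 2)) := by gcongr
        _ = _ := by
            rw [sub_mul, ← Real.exp_add, one_mul]
            ring_nf
    have hM1 : ‖f t‖ ≤ rexp (-(t ^ 2 / 8)) := by
      have := norm_le_norm_add_norm_sub' (f t) (rexp (-(t ^ 2 / 2)) : ℂ)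
      rw [hnorm] at this
      linarith
    have hM2 : ‖(rexp (-(t ^ 2 / 2)) : ℂ)‖ ≤ rexp (-(t ^ 2 / 8)) := by
      rw [hnorm]
      have := norm_nonneg (f t - (rexp (-(t ^ 2 / 2)) : ℂ))
      linarith
    -- `(n - 1)/8 ≥ n/12` holds exactly when `n ≥ 3`; this is the origin of the `12` in `C1`.
    have hexp : rexp (-(t ^ 2 / 8)) ^ (n - 1) ≤ rexp (-(n / 12 : ℝ) * t ^ 2) := by
      rw [← Real.exp_nat_mul, Real.exp_le_exp, Nat.cast_sub (by omega)]
      have : (3 : ℝ) ≤ n := by exact_mod_cast hn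
      push_cast
      nlinarith [sq_nonneg t]
    have hpm : |t| ^ m = |t| ^ (m - 1) * |t| := by
      rw [← pow_succ]; congr 1; omega
    calc _ ≤ n * ‖f t - (rexp (-(t ^ 2 / 2)) : ℂ)‖ * rexp (-(t ^ 2 / 8)) ^ (n - 1) :=
          norm_pow_sub_pow_le hM1 hM2 n
      _ ≤ n * (|t| ^ (m + 1) / (m + 1).factorial * ν₁ + 2 * (|t| ^ m / m.factorial) * ν₂) *
          rexp (-(n / 12 : ℝ) * t ^ 2) := by
          gcongr
          exact hdiff t
      _ = (n * ν₁ / (m + 1).factorial * (|t| ^ m * rexp (-(n / 12 : ℝ) * t ^ 2)) +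
        2 * n * ν₂ / m.factorial * (|t| ^ (m - 1) * rexp (-(n / 12 : ℝ) * t ^ 2))) * |t| := by
          rw [pow_succ, hpm]
          ring
      _ ≤ _ := by
          refine mul_le_mul_of_nonneg_right (le_add_of_nonneg_right ?_) ht'.le
          positivity
  · have ht3 : 3 ≤ t ^ 2 := by
      have h1 : rexp (-(t ^ 2 / 2)) < rexp (-(3 / 2)) := by linarith
      rw [Real.exp_lt_exp] at h1
      linarith
    have ht1 : 1 ≤ |t| := by
      by_contra! h
      rw [← sq_abs] at ht3
      nlinarith
    have h1 : ‖f t ^ n‖ ≤ b ^ (n - 2) * ‖f t‖ ^ 2 := by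
      rw [norm_pow, show n = n - 2 + 2 by omega, pow_add, Nat.add_sub_cancel]
      gcongr
      exact htail t ht3
    -- Of the `n` Gaussian factors, `n - 2` are bounded by `exp(-3/2)`, one by `2ν`, and one is kept
    -- for integrability.
    have h2 : ‖(rexp (-(t ^ 2 / 2)) : ℂ) ^ n‖ ≤
        2 * ν * rexp (-(3 / 2)) ^ (n - 2) * rexp (-(1 / 2 : ℝ) * t ^ 2) := by
      rw [norm_pow, hnorm, show n = n - 2 + 1 + 1 by omega, pow_succ, pow_succ,
        show n - 2 + 1 + 1 - 2 = n - 2 by omega, mul_comm (2 * ν)]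
      have : -(1 / 2 : ℝ) * t ^ 2 = -(t ^ 2 / 2) := by ring
      rw [this]
      gcongr
    -- Replacing `1/|t|` by `|t|` makes the Gaussian tail integral explicit.
    have h3 : 1 ≤ |t| * |t| := by nlinarith
    calc _ ≤ ‖f t ^ n‖ + ‖(rexp (-(t ^ 2 / 2)) : ℂ) ^ n‖ := norm_sub_le _ _
      _ ≤ b ^ (n - 2) * ‖f t‖ ^ 2 +
          2 * ν * rexp (-(3 / 2)) ^ (n - 2) * rexp (-(1 / 2 : ℝ) * t ^ 2) := add_le_add h1 h2
      _ ≤ b ^ (n - 2) * ‖f t‖ ^ 2 * |t| +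
          2 * ν * rexp (-(3 / 2)) ^ (n - 2) * rexp (-(1 / 2 : ℝ) * t ^ 2) * (|t| * |t|) := by
          refine add_le_add (le_mul_of_one_le_right (by positivity) ht1)
            (le_mul_of_one_le_right (by positivity) h3)
      _ = (b ^ (n - 2) * ‖f t‖ ^ 2 +
        2 * ν * rexp (-(3 / 2)) ^ (n - 2) * (|t| ^ 1 * rexp (-(1 / 2 : ℝ) * t ^ 2))) * |t| := by
          ring
      _ ≤ _ := by
          refine mul_le_mul_of_nonneg_right (le_add_of_nonneg_left ?_) ht'.le
          positivity

/-- The first two summands of the pointwise bound integrate to the constant `C1`. -/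
lemma inv_two_pi_mul_moment_le_C1 (k : ℕ) {n : ℕ} (hn : 0 < n) {a : ℝ} (ha : 0 ≤ a) :
    (2 * π)⁻¹ * (n * a / (k + 1).factorial * ∫ x : ℝ, |x| ^ k * rexp (-(n / 12 : ℝ) * x ^ 2)) ≤
      2 * C1 k * (a / (n : ℝ) ^ (((k : ℝ) - 1) / 2)) := by
  have hn' : (0 : ℝ) < n := by exact_mod_cast hn
  rw [integral_abs_pow_mul_exp_neg_mul_sq k (by positivity), C1]
  have h1 : (n / 12 : ℝ) ^ (-((k : ℝ) + 1) / 2) =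
      (12 : ℝ) ^ (((k : ℝ) + 1) / 2) / (n * (n : ℝ) ^ (((k : ℝ) - 1) / 2)) := by
    rw [neg_div, rpow_neg (by positivity), div_rpow hn'.le (by norm_num), inv_div]
    congr 1
    rw [show ((k : ℝ) + 1) / 2 = 1 + ((k : ℝ) - 1) / 2 by ring, rpow_add hn', rpow_one]
  have hG : 0 ≤ Gamma (((k : ℝ) + 1) / 2) := (Gamma_pos_of_pos (by positivity)).le
  rw [h1]
  set G := Gamma (((k : ℝ) + 1) / 2)
  set E := (12 : ℝ) ^ (((k : ℝ) + 1) / 2) with hE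
  set N := (n : ℝ) ^ (((k : ℝ) - 1) / 2) with hN
  have hE0 : 0 < E := by positivity
  have hN0 : 0 < N := by positivity
  have hX : 0 ≤ E * G / (π * (k + 1).factorial) * (a / N) := by positivity
  -- The exact factor is `1/2`, so the stated factor `2` has room to spare.
  have h2 : (2 * π)⁻¹ * (n * a / (k + 1).factorial * (E / (n * N) * G)) =
      1 / 2 * (E * G / (π * (k + 1).factorial) * (a / N)) := by
    field_simp
  rw [h2]
  linarith

/-- The integral equals `2`, and the factor `1/n` comes from `exp(n - 3/2) ≥ n - 1/2 ≥ n/2`. -/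
lemma inv_two_pi_mul_gaussian_tail_le {n : ℕ} (hn : 3 ≤ n) {ν : ℝ} (hν : 0 ≤ ν) :
    (2 * π)⁻¹ * (2 * ν * rexp (-(3 / 2)) ^ (n - 2) *
      ∫ x : ℝ, |x| ^ 1 * rexp (-(1 / 2 : ℝ) * x ^ 2)) ≤
      ν * (4 * rexp (3 / 2) / π) * (rexp (-((n : ℝ) / 2)) / n) := by
  have hn' : (3 : ℝ) ≤ n := by exact_mod_cast hn
  have hn0 : (0 : ℝ) < n := by linarith
  have hI : ∫ x : ℝ, |x| ^ 1 * rexp (-(1 / 2 : ℝ) * x ^ 2) = 2 := by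
    rw [integral_abs_pow_mul_exp_neg_mul_sq 1 (by norm_num)]
    norm_num
  have hexp : rexp (-(3 / 2)) ^ (n - 2) = rexp (3 / 2) * rexp (-((n : ℝ) / 2)) *
      rexp (-(n - 3 / 2)) := by
    rw [← Real.exp_nat_mul, ← Real.exp_add, ← Real.exp_add, Nat.cast_sub (by omega)]
    congr 1
    push_cast
    ring
  have hle : rexp (-((n : ℝ) - 3 / 2)) ≤ 2 / n := by
    have h1 := Real.add_one_le_exp ((n : ℝ) - 3 / 2)
    rw [Real.exp_neg, inv_le_comm₀ (exp_pos _) (by positivity), inv_div]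
    linarith
  rw [hI, hexp]
  calc _ = 2 * ν / π * (rexp (3 / 2) * rexp (-((n : ℝ) / 2))) * rexp (-(n - 3 / 2)) := by
        field_simp
    _ ≤ 2 * ν / π * (rexp (3 / 2) * rexp (-((n : ℝ) / 2))) * (2 / n) := by gcongr
    _ = _ := by field_simp; ring

lemma charFun_gaussianReal_zero_one (t : ℝ) :
    charFun (gaussianReal 0 1) t = (rexp (-(t ^ 2 / 2)) : ℂ) := by
  rw [charFun_gaussianReal]
  push_cast
  congr 1
  ring

lemma integrable_pow_gaussianReal {v : ℝ≥0} (k : ℕ) :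
    Integrable (fun x : ℝ => x ^ k) (gaussianReal 0 v) := by
  have h := (memLp_id_gaussianReal (μ := 0) (v := v) k).integrable_norm_pow'
  rw [← integrable_norm_iff (by fun_prop)]
  simpa using h

/-- The distance to the normal law of a law `ρ` whose characteristic function is that of a
normalized sum of `n` independent variables with law `μ`. -/
theorem abs_cdf_sub_cdf_gaussianReal_le {μ ρ : Measure ℝ} [IsProbabilityMeasure μ]
    [IsProbabilityMeasure ρ] {A : ℝ} (hA : 0 ≤ A) (hμ : μ ≤ ENNReal.ofReal A • volume)
    {m n : ℕ} (hm : 3 ≤ m) (hn : 3 ≤ n) (hmom : ∀ k ≤ m, Integrable (fun x => x ^ k) μ)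
    (heq : ∀ k ≤ m, ∫ x, x ^ k ∂μ = ∫ x, x ^ k ∂(gaussianReal 0 1))
    (hρ : Integrable (fun x => x) ρ)
    (hchar : ∀ t, charFun ρ t = charFun μ ((√n)⁻¹ * t) ^ n) {c ν₁ ν₂ ν : ℝ}
    (hν₁ : ν₁ = ∫ x in {x : ℝ | |x| ≤ c}, |x| ^ (m + 1)
      ∂(μ.toSignedMeasure - (gaussianReal 0 1).toSignedMeasure).variation)
    (hν₂ : ν₂ = ∫ x in {x : ℝ | c < |x|}, |x| ^ m
      ∂(μ.toSignedMeasure - (gaussianReal 0 1).toSignedMeasure).variation)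
    (hν₁' : ν₁ ≤ ν) (hν₂' : ν₂ ≤ ν) (hν : ν < 1 / 2 * rexp (-(3 / 2))) (x : ℝ) :
    |cdf ρ x - cdf (gaussianReal 0 1) x| ≤
      2 * C1 m * (ν₁ / (n : ℝ) ^ (((m : ℝ) - 1) / 2))
        + 2 * C2 m * (ν₂ / (n : ℝ) ^ (((m : ℝ) - 2) / 2))
        + 2 * A * rexp (-(1 / (96 * A ^ 2 * (2 + π) ^ 2))) ^ (n - 2)
        + ν * (4 * rexp (3 / 2) / π) * (rexp (-((n : ℝ) / 2)) / (n : ℝ)) := by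
  have hpi := Real.pi_pos
  have hn0 : (0 : ℝ) < n := by exact_mod_cast (by omega : 0 < n)
  have hsq : 0 < √(n : ℝ) := Real.sqrt_pos.2 hn0
  have hν₁0 : 0 ≤ ν₁ := hν₁ ▸ integral_nonneg fun _ => by positivity
  have hν₂0 : 0 ≤ ν₂ := hν₂ ▸ integral_nonneg fun _ => by positivity
  have hν0 : 0 ≤ ν := hν₁0.trans hν₁'
  have hgint := integrable_pow_gaussianReal (v := 1)
  set b := rexp (-(1 / (96 * A ^ 2 * (2 + π) ^ 2))) with hb
  set f := charFun μ with hf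
  have hvar : ∫ x, x ^ 2 ∂μ ≤ 1 := by
    rw [heq 2 (by omega)]
    have h := variance_fun_id_gaussianReal (μ := 0) (v := 1)
    rw [variance_eq_integral (by fun_prop)] at h
    simpa using h.le
  have hdiff : ∀ t : ℝ, ‖f t - (rexp (-(t ^ 2 / 2)) : ℂ)‖ ≤
      |t| ^ (m + 1) / (m + 1).factorial * ν₁ + 2 * (|t| ^ m / m.factorial) * ν₂ := by
    intro t
    rw [← charFun_gaussianReal_zero_one, hν₁, hν₂]
    exact norm_charFun_sub_charFun_le hmom (fun k _ => hgint k) heq c t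
  have htail : ∀ t : ℝ, 3 ≤ t ^ 2 → ‖f t‖ ≤ b := fun t ht =>
    norm_charFun_le_exp hA hμ (hmom 2 (by omega)) hvar ht
  have hpt := norm_pow_sub_exp_div_le hm hn hν₁0 hν₂0 hν₁' hν₂' hν (exp_pos _).le hdiff htail
  set g : ℝ → ℝ := fun t => ‖f t ^ n - (rexp (-(t ^ 2 / 2)) : ℂ) ^ n‖ / |t| with hg
  have hn12 : (0 : ℝ) < n / 12 := by positivity
  have hI1 := (integrable_abs_pow_mul_exp_neg_mul_sq m hn12).const_mul
    (n * ν₁ / (m + 1).factorial)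
  have hI2 := (integrable_abs_pow_mul_exp_neg_mul_sq (m - 1) hn12).const_mul
    (2 * n * ν₂ / m.factorial)
  have hI3 := (integrable_norm_charFun_sq hA hμ).const_mul (b ^ (n - 2))
  have hI4 := (integrable_abs_pow_mul_exp_neg_mul_sq 1 one_half_pos).const_mul
    (2 * ν * rexp (-(3 / 2)) ^ (n - 2))
  have hgi : Integrable g := by
    refine ((hI1.add hI2).add (hI3.add hI4)).mono' ?_ (.of_forall fun t => ?_)
    · have : Measurable f := measurable_charFun
      exact Measurable.aestronglyMeasurable (by fun_prop)
    · rw [Real.norm_of_nonneg (by positivity)]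
      exact hpt t
  have hscale : (fun t : ℝ => ‖charFun ρ t - charFun (gaussianReal 0 1) t‖ / |t|) =
      fun t => (√(n : ℝ))⁻¹ * g ((√(n : ℝ))⁻¹ * t) := by
    ext t
    have h1 : (rexp (-(((√(n : ℝ))⁻¹ * t) ^ 2 / 2)) : ℂ) ^ n = charFun (gaussianReal 0 1) t := by
      rw [charFun_gaussianReal_zero_one, ← Complex.ofReal_pow, ← Real.exp_nat_mul, mul_pow, inv_pow,
        Real.sq_sqrt hn0.le]
      congr 3
      field_simp
    simp only [hg]
    rw [hchar, h1, abs_mul, abs_of_pos (inv_pos.2 hsq)]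
    field_simp
  have hint : Integrable (fun t : ℝ => ‖charFun ρ t - charFun (gaussianReal 0 1) t‖ / |t|) := by
    rw [hscale]
    exact (hgi.comp_mul_left' (inv_ne_zero hsq.ne')).const_mul _
  have hval : ∫ t : ℝ, ‖charFun ρ t - charFun (gaussianReal 0 1) t‖ / |t| = ∫ t, g t := by
    rw [hscale, integral_const_mul, Measure.integral_comp_mul_left, inv_inv, abs_of_pos hsq,
      smul_eq_mul, inv_mul_cancel_left₀ hsq.ne']
  have hle : ∫ t, g t ≤
      (n * ν₁ / (m + 1).factorial * (∫ t : ℝ, |t| ^ m * rexp (-(n / 12 : ℝ) * t ^ 2)) +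
        2 * n * ν₂ / m.factorial * ∫ t : ℝ, |t| ^ (m - 1) * rexp (-(n / 12 : ℝ) * t ^ 2)) +
      (b ^ (n - 2) * (∫ t, ‖f t‖ ^ 2) + 2 * ν * rexp (-(3 / 2)) ^ (n - 2) *
        ∫ t : ℝ, |t| ^ 1 * rexp (-(1 / 2 : ℝ) * t ^ 2)) := by
    rw [← integral_const_mul, ← integral_const_mul, ← integral_const_mul, ← integral_const_mul,
      ← integral_add hI1 hI2, ← integral_add hI3 hI4,
      ← integral_add (hI1.fun_add hI2) (hI3.fun_add hI4)]
    exact integral_mono hgi ((hI1.add hI2).add (hI3.add hI4)) hpt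
  refine (abs_cdf_sub_cdf_le hρ (by simpa using hgint 1) hint x).trans ?_
  rw [hval]
  have hT1 := inv_two_pi_mul_moment_le_C1 m (by omega : 0 < n) hν₁0
  have hT2 : (2 * π)⁻¹ * (2 * n * ν₂ / m.factorial *
      ∫ t : ℝ, |t| ^ (m - 1) * rexp (-(n / 12 : ℝ) * t ^ 2)) ≤
      2 * C2 m * (ν₂ / (n : ℝ) ^ (((m : ℝ) - 2) / 2)) := by
    -- The `ν₂` term is twice the first estimate at order `m - 1`, whence `C2 m = 2 * C1 (m - 1)`.
    obtain ⟨k, rfl⟩ : ∃ k, m = k + 1 := ⟨m - 1, by omega⟩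
    have h := inv_two_pi_mul_moment_le_C1 k (by omega : 0 < n) hν₂0
    have hcast : (((k + 1 : ℕ) : ℝ) - 2) / 2 = ((k : ℝ) - 1) / 2 := by push_cast; ring
    rw [hcast, C2, Nat.add_sub_cancel]
    calc _ = 2 * ((2 * π)⁻¹ * (n * ν₂ / (k + 1).factorial *
        ∫ x : ℝ, |x| ^ k * rexp (-(n / 12 : ℝ) * x ^ 2))) := by ring
      _ ≤ 2 * (2 * C1 k * (ν₂ / (n : ℝ) ^ (((k : ℝ) - 1) / 2))) := by gcongr
      _ = _ := by ring
  have hT3 : (2 * π)⁻¹ * (b ^ (n - 2) * ∫ t, ‖f t‖ ^ 2) ≤ 2 * A * b ^ (n - 2) := by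
    have hb0 : 0 ≤ b ^ (n - 2) := pow_nonneg (exp_pos _).le _
    calc _ ≤ (2 * π)⁻¹ * (b ^ (n - 2) * (2 * π * A)) := by
          gcongr
          exact integral_norm_charFun_sq_le hA hμ
      _ = A * b ^ (n - 2) := by field_simp
      _ ≤ _ := by nlinarith [mul_nonneg hA hb0]
  have hT4 := inv_two_pi_mul_gaussian_tail_le hn hν0
  refine (mul_le_mul_of_nonneg_left hle (by positivity)).trans ?_
  rw [mul_add, mul_add, mul_add]
  linarith

/-! ### Rescaling by `σ` and recovering moments from pseudomoments -/

lemma map_div_le_smul_volume {p : ℝ → ℝ} {A σ : ℝ} (hσ : 0 < σ) (hp : ∀ x, p x ≤ A) :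
    (volume.withDensity fun x => ENNReal.ofReal (p x)).map (fun x => x / σ) ≤
      ENNReal.ofReal (σ * A) • volume := by
  have hL : (volume.withDensity fun x => ENNReal.ofReal (p x)) ≤ ENNReal.ofReal A • volume := by
    rw [← withDensity_const]
    exact withDensity_mono (.of_forall fun x => ENNReal.ofReal_le_ofReal (hp x))
  refine Measure.le_iff.2 fun s hs => ?_
  rw [Measure.map_apply (by fun_prop) hs]
  refine (hL _).trans (le_of_eq ?_)
  simp only [Measure.smul_apply, smul_eq_mul, div_eq_mul_inv]
  rw [Real.volume_preimage_mul_right (inv_ne_zero hσ.ne'), inv_inv, abs_of_pos hσ,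
    ENNReal.ofReal_mul hσ.le]
  ring

section Pseudomoments

variable {L : Measure ℝ} [IsFiniteMeasure L] {σ : ℝ} {k : ℕ}

/-- Adding the normal law back to `dH` recovers the law of `ξ/σ`, so integrability against the
variation passes to that law. -/
lemma PseudomomentExists.integrable_pow (h : PseudomomentExists L σ k)
    (hg : Integrable (fun x : ℝ => x ^ k) (gaussianReal 0 1)) :
    Integrable (fun x => x ^ k) (L.map fun x => x / σ) := by
  have h1 : (gaussianReal 0 1).toSignedMeasure.Integrable fun x : ℝ => x ^ k := by
    rwa [VectorMeasure.Integrable, Measure.variation_toSignedMeasure]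
  have h2 := VectorMeasure.Integrable.add_vectorMeasure h h1
  rwa [dH, sub_add_cancel, VectorMeasure.Integrable, Measure.variation_toSignedMeasure] at h2

lemma pseudomoment_eq_sub
    (hL : Integrable (fun x => x ^ k) (L.map fun x => x / σ))
    (hg : Integrable (fun x : ℝ => x ^ k) (gaussianReal 0 1)) :
    pseudomoment L σ k =
      ∫ x, x ^ k ∂(L.map fun x => x / σ) - ∫ x, x ^ k ∂(gaussianReal 0 1) := by
  rw [pseudomoment, dH, VectorMeasure.integral_sub_vectorMeasure
    (by rwa [VectorMeasure.Integrable, Measure.variation_toSignedMeasure])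
    (by rwa [VectorMeasure.Integrable, Measure.variation_toSignedMeasure]),
    VectorMeasure.integral_toSignedMeasure, VectorMeasure.integral_toSignedMeasure]

end Pseudomoments

end PseudoCLT

/-! ### The main theorem for sums of independent variables -/

open PseudoCLT in
theorem corollary1 {Ω : Type*} [MeasurableSpace Ω] (P : Measure Ω) [IsProbabilityMeasure P]
    (ξ : ℕ → Ω → ℝ) (σ : ℝ) (hσ : 0 < σ)
    -- i.i.d. random variables with mean `0` and variance `σ²`
    (hindep : iIndepFun ξ P) (hident : ∀ i, IdentDistrib (ξ i) (ξ 0) P P)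
    (hL2 : MemLp (ξ 0) 2 P) (hmean : ∫ ω, ξ 0 ω ∂P = 0) (hvar : variance (ξ 0) P = σ ^ 2)
    -- the common law has a density `p ≤ A₁`
    (p : ℝ → ℝ) (A₁ : ℝ) (hp_meas : Measurable p) (hp_nonneg : ∀ x, 0 ≤ p x)
    (hp_dens : P.map (ξ 0) = volume.withDensity (fun x => ENNReal.ofReal (p x)))
    (hp_le : ∀ x, p x ≤ A₁)
    -- vanishing pseudomoments up to order `m`, bounded truncated pseudomoments
    (m : ℕ) (hm : 3 ≤ m)
    (hexists : ∀ k, 3 ≤ k → k ≤ m → PseudoCLT.PseudomomentExists (P.map (ξ 0)) σ k)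
    (hzero : ∀ k, 3 ≤ k → k ≤ m → PseudoCLT.pseudomoment (P.map (ξ 0)) σ k = 0)
    (n : ℕ) (hn : 3 ≤ n)
    (hnu : PseudoCLT.nu (P.map (ξ 0)) σ n m < 1 / 2 * Real.exp (-(3 / 2))) :
    PseudoCLT.b1 A₁ σ < 1 ∧
    (⨆ x : ℝ, |cdf (P.map (PseudoCLT.S ξ σ n)) x - cdf (gaussianReal 0 1) x|) ≤
      2 * PseudoCLT.C1 m *
          (PseudoCLT.nu1 (P.map (ξ 0)) σ n m / (n : ℝ) ^ (((m : ℝ) - 1) / 2))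
        + 2 * PseudoCLT.C2 m *
          (PseudoCLT.nu2 (P.map (ξ 0)) σ n m / (n : ℝ) ^ (((m : ℝ) - 2) / 2))
        + 2 * σ * A₁ * PseudoCLT.b1 A₁ σ ^ (n - 2)
        + PseudoCLT.nu (P.map (ξ 0)) σ n m * (4 * Real.exp (3 / 2) / Real.pi)
          * (Real.exp (-((n : ℝ) / 2)) / (n : ℝ)) := by

  have hξ : ∀ i, AEMeasurable (ξ i) P := fun i => (hident i).aemeasurable_fst
  have hdiv : Measurable fun x : ℝ => x / σ := by fun_prop
  have : IsProbabilityMeasure (P.map (ξ 0)) := Measure.isProbabilityMeasure_map (hξ 0)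
  set μ : Measure ℝ := (P.map (ξ 0)).map fun x => x / σ with hμdef
  have : IsProbabilityMeasure μ := Measure.isProbabilityMeasure_map hdiv.aemeasurable
  have hμmap : μ = P.map (fun ω => ξ 0 ω / σ) :=
    AEMeasurable.map_map_of_aemeasurable hdiv.aemeasurable (hξ 0)
  have hX0 : AEMeasurable (fun ω => ξ 0 ω / σ) P := (hξ 0).div_const σ
  have hA₁ : 0 ≤ A₁ := (hp_nonneg 0).trans (hp_le 0)
  have hA : 0 ≤ σ * A₁ := by positivity
  have hμle : μ ≤ ENNReal.ofReal (σ * A₁) • volume := by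
    rw [hμdef, hp_dens]
    exact map_div_le_smul_volume hσ hp_le
  -- With `A₁ = 0` the law would vanish. Positivity makes `b1 < 1` strict, since division by zero
  -- would give `b1 = 1`.
  have hA₁pos : 0 < A₁ := by
    refine hA₁.lt_of_ne fun h => ?_
    have h1 := hμle Set.univ
    simp [← h] at h1
  have hgint := integrable_pow_gaussianReal (v := 1)
  have hint2 : Integrable (fun ω => ξ 0 ω ^ 2) P := hL2.integrable_sq
  have hint1 : Integrable (ξ 0) P := hL2.integrable one_le_two
  have hmom : ∀ k ≤ m, Integrable (fun x => x ^ k) μ := by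
    intro k hk
    rcases lt_or_ge k 3 with hk3 | hk3
    · rw [hμmap, integrable_map_measure (by fun_prop) hX0]
      interval_cases k
      · simp [Function.comp_def]
      · simpa [Function.comp_def] using hint1.div_const σ
      · simpa [Function.comp_def, div_pow] using hint2.div_const (σ ^ 2)
    · exact (hexists k hk3 hk).integrable_pow (hgint k)
  -- Orders `0`, `1`, `2` agree by normalization, the others by the vanishing pseudomoments.
  have heq : ∀ k ≤ m, ∫ x, x ^ k ∂μ = ∫ x, x ^ k ∂(gaussianReal 0 1) := by
    intro k hk
    rcases lt_or_ge k 3 with hk3 | hk3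
    · rw [hμmap, integral_map hX0 (by fun_prop)]
      interval_cases k
      · simp
      · simp [integral_div, hmean]
      · have h := variance_fun_id_gaussianReal (μ := 0) (v := 1)
        rw [variance_eq_integral (by fun_prop)] at h
        rw [variance_of_integral_eq_zero (hξ 0) hmean] at hvar
        simp only [integral_id_gaussianReal, sub_zero, NNReal.coe_one] at h
        simp only [div_pow, integral_div, h]
        rw [div_eq_one_iff_eq (by positivity)]
        exact hvar
    · have h := hzero k hk3 hk
      rw [pseudomoment_eq_sub (hmom k hk) (hgint k)] at h
      exact sub_eq_zero.1 h
  have hSeq : S ξ σ n = fun ω => (√(n : ℝ))⁻¹ * ∑ i ∈ Finset.range n, ξ i ω / σ := by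
    ext ω
    rw [S, ← Finset.sum_div, mul_inv]
    ring
  have hSint : Integrable (S ξ σ n) P := by
    refine (integrable_finsetSum _ fun i _ => ?_).const_mul _
    exact (hident i).symm.integrable_snd hint1
  have hρ : IsProbabilityMeasure (P.map (S ξ σ n)) :=
    Measure.isProbabilityMeasure_map hSint.aemeasurable
  have hρint : Integrable (fun x => x) (P.map (S ξ σ n)) := by
    rw [integrable_map_measure (by fun_prop) hSint.aemeasurable]
    exact hSint
  have hchar : ∀ t, charFun (P.map (S ξ σ n)) t = charFun μ ((√(n : ℝ))⁻¹ * t) ^ n := by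
    intro t
    rw [hSeq, hμmap]
    exact charFun_inv_sqrt_mul_sum (X := fun i ω => ξ i ω / σ)
      (hindep.comp (fun _ x => x / σ) fun _ => hdiv) (fun i => (hident i).comp hdiv)
  have hb1 : b1 A₁ σ = Real.exp (-(1 / (96 * (σ * A₁) ^ 2 * (2 + Real.pi) ^ 2))) := by
    rw [b1]
    congr 4
    ring
  refine ⟨?_, ?_⟩
  · rw [b1, Real.exp_lt_one_iff, neg_lt_zero]
    have := Real.pi_pos
    positivity
  · refine ciSup_le fun x => ?_
    -- The general estimate holds for any truncation level `c`; only here is it set to `σ√n`.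
    have h := abs_cdf_sub_cdf_gaussianReal_le hA hμle hm hn hmom heq hρint hchar
      (c := σ * √(n : ℝ)) (ν₁ := nu1 (P.map (ξ 0)) σ n m) (ν₂ := nu2 (P.map (ξ 0)) σ n m)
      (ν := nu (P.map (ξ 0)) σ n m) rfl rfl (le_max_left _ _) (le_max_right _ _) hnu x
    rw [hb1]
    rwa [← mul_assoc 2 σ A₁] at h
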